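/- Let $G$ be a connected Lie group. All manifolds and maps are of class $C^\infty$. Let $SO(2)$ act on the unit sphere $S^2\subset\mathbf R^3$ by rotations of the first two coordinates, so that it fixes the poles $(0,0,\pm1)$. An $SO(2)$-equivariant principal $G$-bundle $\xi$ over $S^2$ is a smooth (locally trivial) principal $G$-bundle $p\colon E\to S^2$, with free right action of $G$ on $E$, denoted $\xi^\flat$, together with a smooth left action of $SO(2)$ on $E$ that commutes with the action of $G$ and for which $p$ is $SO(2)$-equivariant. Two of them are isomorphic if there is an $SO(2)$- and $G$-equivariant diffeomorphism of their total spaces over the identity of $S^2$; let $\mathcal E(2,G)$ be the set of isomorphism classes. Let $\mathcal R(2,G)$ be the set of smooth homomorphisms $SO(2)\to G$ modulo conjugation by elements of $G$. Given $\xi$, choose $a,b\in E$ with $p(a)=(0,0,-1)$ and $p(b)=(0,0,1)$, and let $\alpha,\beta\colon SO(2)\to G$ be defined by $A\cdot a=a\cdot\alpha(A)$ and $A\cdot b=b\cdot\beta(A)$. These are smooth homomorphisms whose classes in $\mathcal R(2,G)$ depend only on the isomorphism class of $\xi$, and $J\colon\mathcal E(2,G)\to\mathcal R(2,G)\times\mathcal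 R(2,G)$ is defined by $J(\xi)=([\alpha],[\beta])$. For a principal $G$-bundle $\eta$ over $S^2$ let $C(\eta)=\partial[\mathrm{id}_{S^2}]\in\pi_1(G,1)$, where $\partial\colon\pi_2(S^2)\to\pi_1(G)$ is the boundary operator of the homotopy exact sequence of $\eta$. Explicitly: if $a\in E$ lies over $(0,0,-1)$ and $F\colon D^2\to E$ is a continuous lift, with $F(1)=a$, of the map $D^2\to S^2$, $w\mapsto(2\sqrt{1-|w|^2}\,w,\,1-2|w|^2)$ (with $D^2\subset\mathbf C=\mathbf R^2$, which collapses $\partial D^2$ to the south pole), then $F(z)=a\cdot g(z)$ for $z\in S^1$, and $C(\eta)=[g]$. For smooth homomorphisms $\alpha,\beta\colon SO(2)\to G$ let $\psi(\alpha,\beta)\in\pi_1(G,1)$ be the class of the loop $z\mapsto\alpha(z)\beta(z)^{-1}$, $z\in S^1\cong SO(2)$. Then: (i) the map $J\colon\mathcal E(2,G)\to\mathcal R(2,G)\times\mathcal R(2,G)$ is a bijection; (ii) if $J(\xi)=([\alpha],[\beta])$, then $C(\xi^\flat)$ is well defined (such a lift $F$ exists, and $[g]$ depends neither on $F$ nor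 on $a$) and $C(\xi^\flat)=\psi(\alpha,\beta)$ in $\pi_1(G,1)$. -/

import Mathlib

open scoped Manifold ContDiff EuclideanGeometry

noncomputable section

namespace EquivariantBundle

/-- The matrix group `SO(2)`. -/
abbrev SO2 : Type := Matrix.specialOrthogonalGroup (Fin 2) ℝ

/-- Rotation by the angle of a unit complex number. -/
def rot (z : Circle) : SO2 :=
  ⟨!![(z : ℂ).re, -(z : ℂ).im; (z : ℂ).im, (z : ℂ).re], by
    have h : (z : ℂ).re * (z : ℂ).re + (z : ℂ).im * (z : ℂ).im = 1 := by
      rw [← Complex.normSq_apply, Circle.normSq_coe]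
    rw [Matrix.of_mem_specialOrthogonalGroup_fin_two_iff]
    refine ⟨rfl, rfl, ?_⟩
    nlinarith⟩

theorem SO2.entries (A : SO2) : A.1 0 0 = A.1 1 1 ∧ A.1 0 1 = -A.1 1 0 ∧
    A.1 0 0 ^ 2 + A.1 1 0 ^ 2 = 1 := by
  obtain ⟨h1, h2, h3⟩ := Matrix.mem_specialOrthogonalGroup_fin_two_iff.1 A.2
  exact ⟨h1, h2, by rw [h2] at h3; linarith [neg_sq (A.1 1 0)]⟩

/-- The identification of `SO(2)` with the unit circle, as groups and as topological spaces. -/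
def rotEquiv : Circle ≃* SO2 where
  toFun := rot
  invFun A := ⟨⟨A.1 0 0, A.1 1 0⟩, by
    rw [Submonoid.unitSphere, ← SetLike.mem_coe]
    simp only [Submonoid.coe_set_mk, Subsemigroup.coe_set_mk, mem_sphere_zero_iff_norm]
    rw [← sq_eq_sq₀ (norm_nonneg _) zero_le_one, ← Complex.normSq_eq_norm_sq, Complex.normSq_mk]
    linarith [A.entries.2.2, sq (A.1 0 0), sq (A.1 1 0)]⟩
  left_inv z := by ext; simp [rot]
  right_inv A := by
    obtain ⟨h1, h2, -⟩ := A.entries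
    apply Subtype.ext
    ext i j
    fin_cases i <;> fin_cases j <;> simp [rot, h1, h2]
  map_mul' z w := by
    apply Subtype.ext
    ext i j
    fin_cases i <;> fin_cases j <;> simp [rot] <;> ring

def rotHomeo : Circle ≃ₜ SO2 where
  toEquiv := rotEquiv.toEquiv
  continuous_toFun := by
    refine Continuous.subtype_mk ?_ _
    refine continuous_matrix fun i j => ?_
    fin_cases i <;> fin_cases j <;> simp <;> fun_prop
  continuous_invFun := by
    refine Continuous.subtype_mk ?_ _
    have h : ∀ i j, Continuous fun A : SO2 => A.1 i j := fun i j =>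
      continuous_subtype_val.matrix_elem i j
    exact Complex.equivRealProdCLM.symm.continuous.comp ((h 0 0).prodMk (h 1 0))

instance : ChartedSpace (EuclideanSpace ℝ (Fin 1)) SO2 where
  atlas := (rotHomeo.symm.toOpenPartialHomeomorph.trans ·) ''
    atlas (EuclideanSpace ℝ (Fin 1)) Circle
  chartAt A := rotHomeo.symm.toOpenPartialHomeomorph.trans
    (chartAt (EuclideanSpace ℝ (Fin 1)) (rotHomeo.symm A))
  mem_chart_source A := by simp
  chart_mem_atlas A := ⟨_, chart_mem_atlas _ _, rfl⟩

instance : IsManifold (𝓡 1) ∞ SO2 := by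
  refine { compatible := ?_ }
  rintro _ _ ⟨e, he, rfl⟩ ⟨e', he', rfl⟩
  have h : (rotHomeo.symm.toOpenPartialHomeomorph.trans e).symm.trans
      (rotHomeo.symm.toOpenPartialHomeomorph.trans e') = e.symm.trans e' := by
    ext x <;> simp
  simp only
  rw [h]
  exact HasGroupoid.compatible he he'

theorem chartAt_SO2 (A : SO2) : chartAt (EuclideanSpace ℝ (Fin 1)) A =
    rotHomeo.symm.toOpenPartialHomeomorph.trans
      (chartAt (EuclideanSpace ℝ (Fin 1)) (rotHomeo.symm A)) := rfl

theorem contMDiff_rotHomeo : ContMDiff (𝓡 1) (𝓡 1) ∞ rotHomeo := by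
  intro z
  rw [contMDiffAt_iff]
  refine ⟨rotHomeo.continuous.continuousAt, ?_⟩
  have := (contMDiffAt_iff.1 (contMDiffAt_id (I := 𝓡 1) (n := ∞) (x := z))).2
  convert this using 1
  ext1 x
  simp [extChartAt, chartAt_SO2]

theorem contMDiff_rotHomeo_symm : ContMDiff (𝓡 1) (𝓡 1) ∞ rotHomeo.symm := by
  intro A
  rw [contMDiffAt_iff]
  refine ⟨rotHomeo.symm.continuous.continuousAt, ?_⟩
  have := (contMDiffAt_iff.1 (contMDiffAt_id (I := 𝓡 1) (n := ∞) (x := rotHomeo.symm A))).2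
  convert this using 1
  · ext1 x
    simp [extChartAt, chartAt_SO2]
  · simp [extChartAt, chartAt_SO2]

instance : LieGroup (𝓡 1) ∞ SO2 where
  contMDiff_mul := by
    have h : ContMDiff ((𝓡 1).prod (𝓡 1)) (𝓡 1) ∞ fun p : SO2 × SO2 =>
        rotHomeo (rotHomeo.symm p.1 * rotHomeo.symm p.2) :=
      contMDiff_rotHomeo.comp ((contMDiff_rotHomeo_symm.comp contMDiff_fst).mul
        (contMDiff_rotHomeo_symm.comp contMDiff_snd))
    convert h using 2 with p
    rw [show rotHomeo (rotHomeo.symm p.1 * rotHomeo.symm p.2) =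
      rotHomeo (rotHomeo.symm p.1) * rotHomeo (rotHomeo.symm p.2) from rotEquiv.map_mul _ _]
    simp
  contMDiff_inv := by
    have h : ContMDiff (𝓡 1) (𝓡 1) ∞ fun p : SO2 => rotHomeo (rotHomeo.symm p)⁻¹ :=
      contMDiff_rotHomeo.comp contMDiff_rotHomeo_symm.inv
    convert h using 2 with p
    rw [show rotHomeo (rotHomeo.symm p)⁻¹ = (rotHomeo (rotHomeo.symm p))⁻¹ from
      map_inv rotEquiv _]
    simp


/-- The unit sphere of `ℝ³`. -/
abbrev S2 : Type := Metric.sphere (0 : EuclideanSpace ℝ (Fin 3)) 1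

theorem mem_S2 {a b c : ℝ} (h : a ^ 2 + b ^ 2 + c ^ 2 = 1) :
    !₂[a, b, c] ∈ Metric.sphere (0 : EuclideanSpace ℝ (Fin 3)) 1 := by
  rw [mem_sphere_zero_iff_norm, EuclideanSpace.norm_eq, Real.sqrt_eq_one, Fin.sum_univ_three]
  simpa using h

theorem S2.sq_sum (x : S2) : x.1 0 ^ 2 + x.1 1 ^ 2 + x.1 2 ^ 2 = 1 := by
  have h := mem_sphere_zero_iff_norm.1 x.2
  rw [EuclideanSpace.norm_eq, Real.sqrt_eq_one, Fin.sum_univ_three] at h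
  simpa using h

/-- The pole `(0, 0, -1)`. -/
def southPole : S2 := ⟨!₂[0, 0, -1], mem_S2 (by norm_num)⟩

/-- The pole `(0, 0, 1)`. -/
def northPole : S2 := ⟨!₂[0, 0, 1], mem_S2 (by norm_num)⟩

/-- The action of `SO(2)` on the sphere by rotations fixing the two poles: `A` acts on the first
two coordinates. -/
def rotate (A : SO2) (x : S2) : S2 :=
  ⟨!₂[A.1 0 0 * x.1 0 + A.1 0 1 * x.1 1, A.1 1 0 * x.1 0 + A.1 1 1 * x.1 1, x.1 2], mem_S2 (by
    obtain ⟨h1, h2, h3⟩ := A.entries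
    rw [← h1, h2]
    linear_combination (x.1 0 ^ 2 + x.1 1 ^ 2) * h3 + x.sq_sum)⟩

theorem rotate_southPole (A : SO2) : rotate A southPole = southPole := by
  apply Subtype.ext; ext i; fin_cases i <;> simp [rotate, southPole]

theorem rotate_northPole (A : SO2) : rotate A northPole = northPole := by
  apply Subtype.ext; ext i; fin_cases i <;> simp [rotate, northPole]

universe u v

section Bundles

/-- The model with corners of the total space of a bundle over `S²` whose fibre is a manifold
modelled on `V`. -/
abbrev totalModel (V : Type v) [NormedAddCommGroup V] [NormedSpace ℝ V] :
    ModelWithCorners ℝ (EuclideanSpace ℝ (Fin 2) × V) (ModelProd (EuclideanSpace ℝ (Fin 2)) V) :=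
  (𝓡 2).prod 𝓘(ℝ, V)

/-- A smooth principal `G`-bundle over `S²`. -/
structure PrincipalBundle (V : Type v) [NormedAddCommGroup V] [NormedSpace ℝ V]
    (G : Type u) [Group G] [TopologicalSpace G] [ChartedSpace V G] where
  E : Type u
  [topE : TopologicalSpace E]
  [t2E : T2Space E]
  [scE : SecondCountableTopology E]
  [chartedE : ChartedSpace (ModelProd (EuclideanSpace ℝ (Fin 2)) V) E]
  [manifoldE : IsManifold (totalModel V) ∞ E]
  proj : E → S2
  proj_smooth : ContMDiff (totalModel V) (𝓡 2) ∞ proj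
  /-- The right action of `G`. -/
  act : E → G → E
  act_one : ∀ z, act z 1 = z
  act_mul : ∀ z g h, act z (g * h) = act (act z g) h
  act_free : ∀ z g, act z g = z → g = 1
  act_smooth : ContMDiff ((totalModel V).prod 𝓘(ℝ, V)) (totalModel V) ∞
    fun q : E × G => act q.1 q.2
  proj_act : ∀ z g, proj (act z g) = proj z
  /-- Every point of the base has an open neighbourhood `U` and a `G`-equivariant diffeomorphism
  of `proj⁻¹(U)` with `U × G` over `U`. -/
  locally_trivial : ∀ x : S2, ∃ e : Bundle.Trivialization G proj, x ∈ e.baseSet ∧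
    ContMDiffOn (totalModel V) ((𝓡 2).prod 𝓘(ℝ, V)) ∞ e e.source ∧
    ContMDiffOn ((𝓡 2).prod 𝓘(ℝ, V)) (totalModel V) ∞ e.toOpenPartialHomeomorph.symm e.target ∧
    ∀ z ∈ e.source, ∀ g, e (act z g) = ((e z).1, (e z).2 * g)

attribute [instance] PrincipalBundle.topE PrincipalBundle.t2E PrincipalBundle.scE
  PrincipalBundle.chartedE PrincipalBundle.manifoldE

/-- An `SO(2)`-equivariant smooth principal `G`-bundle over `S²`. -/
structure EquivariantPrincipalBundle (V : Type v) [NormedAddCommGroup V] [NormedSpace ℝ V]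
    (G : Type u) [Group G] [TopologicalSpace G] [ChartedSpace V G]
    extends PrincipalBundle V G where
  /-- The left action of `SO(2)`. -/
  rotAct : SO2 → E → E
  rotAct_one : ∀ z, rotAct 1 z = z
  rotAct_mul : ∀ A B z, rotAct (A * B) z = rotAct A (rotAct B z)
  rotAct_smooth : ContMDiff ((𝓡 1).prod (totalModel V)) (totalModel V) ∞
    fun q : SO2 × E => rotAct q.1 q.2
  rotAct_act : ∀ A z g, rotAct A (act z g) = act (rotAct A z) g
  proj_rotAct : ∀ A z, proj (rotAct A z) = rotate A (proj z)

variable {V : Type v} [NormedAddCommGroup V] [NormedSpace ℝ V]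
  {G : Type u} [Group G] [TopologicalSpace G] [ChartedSpace V G]

/-- Isomorphism of equivariant bundles: an `SO(2)`- and `G`-equivariant diffeomorphism over the
identity of `S²`. -/
def Isomorphic (ξ ξ' : EquivariantPrincipalBundle V G) : Prop :=
  ∃ h : Diffeomorph (totalModel V) (totalModel V) ξ.E ξ'.E ∞,
    (∀ z g, h (ξ.act z g) = ξ'.act (h z) g) ∧
    (∀ A z, h (ξ.rotAct A z) = ξ'.rotAct A (h z)) ∧
    ∀ z, ξ'.proj (h z) = ξ.proj z

variable (V G) in
instance isoSetoid : Setoid (EquivariantPrincipalBundle V G) where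
  r := Isomorphic
  iseqv :=
    { refl := fun ξ => ⟨Diffeomorph.refl _ _ _, fun _ _ => rfl, fun _ _ => rfl, fun _ => rfl⟩
      symm := by
        rintro ξ ξ' ⟨h, h1, h2, h3⟩
        refine ⟨h.symm, fun z g => ?_, fun A z => ?_, fun z => ?_⟩
        · refine h.injective (?_ : h _ = h _)
          rw [h1, h.apply_symm_apply, h.apply_symm_apply]
        · refine h.injective (?_ : h _ = h _)
          rw [h2, h.apply_symm_apply, h.apply_symm_apply]
        · rw [← h3, h.apply_symm_apply]
      trans := by
        rintro ξ ξ' ξ'' ⟨h, h1, h2, h3⟩ ⟨k, k1, k2, k3⟩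
        refine ⟨h.trans k, fun z g => ?_, fun A z => ?_, fun z => ?_⟩
        · simp [h1, k1]
        · simp [h2, k2]
        · simp [h3, k3] }

variable (V G) in
/-- The set of isomorphism classes of `SO(2)`-equivariant principal `G`-bundles over `S²`. -/
def BundleClasses : Type _ := Quotient (isoSetoid V G)

variable (V G) in
/-- Smooth homomorphisms `SO(2) → G`. -/
abbrev SmoothHom : Type _ := ContMDiffMonoidMorphism (𝓡 1) 𝓘(ℝ, V) ∞ SO2 G

variable (V G) in
/-- Two smooth homomorphisms `SO(2) → G` are equivalent if they are conjugate by an element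
of `G`. -/
instance conjSetoid : Setoid (SmoothHom V G) where
  r α β := ∃ g : G, ∀ A, β A = g * α A * g⁻¹
  iseqv :=
    { refl := fun α => ⟨1, fun A => by simp⟩
      symm := by
        rintro α β ⟨g, h⟩
        exact ⟨g⁻¹, fun A => by rw [h]; group⟩
      trans := by
        rintro α β γ ⟨g, h⟩ ⟨k, h'⟩
        exact ⟨k * g, fun A => by rw [h', h]; group⟩ }

variable (V G) in
/-- The set of conjugacy classes of smooth homomorphisms `SO(2) → G`. -/
def RepClasses : Type _ := Quotient (conjSetoid V G)

namespace PrincipalBundle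

variable (η : PrincipalBundle V G)

theorem exists_point (x : S2) : ∃ a : η.E, η.proj a = x := by
  obtain ⟨e, hx, -⟩ := η.locally_trivial x
  exact ⟨e.toOpenPartialHomeomorph.symm (x, 1), e.proj_symm_apply' hx⟩

theorem act_left_cancel {z : η.E} {g h : G} (H : η.act z g = η.act z h) : g = h := by
  have : η.act z (g * h⁻¹) = z := by rw [η.act_mul, H, ← η.act_mul, mul_inv_cancel, η.act_one]
  exact mul_inv_eq_one.1 (η.act_free _ _ this)

theorem exists_act_eq {z w : η.E} (H : η.proj w = η.proj z) : ∃ g, w = η.act z g := by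
  obtain ⟨e, hx, -, -, he⟩ := η.locally_trivial (η.proj z)
  have hz : z ∈ e.source := e.mem_source.2 hx
  have hw : w ∈ e.source := e.mem_source.2 (H ▸ hx)
  have hzg : η.act z ((e z).2⁻¹ * (e w).2) ∈ e.source :=
    e.mem_source.2 ((η.proj_act _ _).symm ▸ hx)
  refine ⟨(e z).2⁻¹ * (e w).2, e.injOn hw hzg (?_ : e _ = e _)⟩
  rw [he z hz]
  ext1
  · simp [e.coe_fst hz, e.coe_fst hw, H]
  · simp

end PrincipalBundle

namespace EquivariantPrincipalBundle

variable (ξ : EquivariantPrincipalBundle V G)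

theorem exists_rep {a : ξ.E} (ha : ∀ A, rotate A (ξ.proj a) = ξ.proj a) (A : SO2) :
    ∃ g, ξ.rotAct A a = ξ.act a g :=
  ξ.exists_act_eq (by rw [ξ.proj_rotAct, ha])

theorem contMDiff_of_rep [LieGroup 𝓘(ℝ, V) ∞ G] {a : ξ.E}
    (ha : ∀ A, rotate A (ξ.proj a) = ξ.proj a)
    {α : SO2 → G} (hα : ∀ A, ξ.rotAct A a = ξ.act a (α A)) :
    ContMDiff (𝓡 1) 𝓘(ℝ, V) ∞ α := by
  obtain ⟨e, hx, he1, -, he⟩ := ξ.locally_trivial (ξ.proj a)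
  have hs : ∀ A, ξ.rotAct A a ∈ e.source := fun A =>
    e.mem_source.2 (by rw [ξ.proj_rotAct, ha]; exact hx)
  have h1 : ContMDiff (𝓡 1) (totalModel V) ∞ fun A => ξ.rotAct A a :=
    ξ.rotAct_smooth.comp (contMDiff_id.prodMk contMDiff_const)
  have h2 : ContMDiff (𝓡 1) 𝓘(ℝ, V) ∞ fun A => (e (ξ.rotAct A a)).2 :=
    contMDiff_snd.comp (he1.comp_contMDiff h1 hs)
  have h3 : α = fun A => (e a).2⁻¹ * (e (ξ.rotAct A a)).2 := by
    funext A
    rw [hα, he a (e.mem_source.2 hx)]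
    simp
  rw [h3]
  exact contMDiff_const.mul h2

/-- The isotropy representation `α` at a point `a` above a fixed point of the rotations:
`A · a = a · α(A)`. -/
def isotropyRep [LieGroup 𝓘(ℝ, V) ∞ G] (a : ξ.E)
    (ha : ∀ A, rotate A (ξ.proj a) = ξ.proj a) : SmoothHom V G where
  toFun A := (ξ.exists_rep ha A).choose
  map_one' := by
    apply ξ.act_left_cancel (z := a)
    rw [← (ξ.exists_rep ha 1).choose_spec, ξ.rotAct_one, ξ.act_one]
  map_mul' A B := by
    apply ξ.act_left_cancel (z := a)
    have hB := congrArg (ξ.rotAct A) (ξ.exists_rep ha B).choose_spec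
    rw [← (ξ.exists_rep ha (A * B)).choose_spec, ξ.rotAct_mul, hB, ξ.rotAct_act, ξ.act_mul,
      ← (ξ.exists_rep ha A).choose_spec]
  contMDiff_toFun := ξ.contMDiff_of_rep ha fun A => (ξ.exists_rep ha A).choose_spec

theorem isotropyRep_spec [LieGroup 𝓘(ℝ, V) ∞ G] (a : ξ.E)
    (ha : ∀ A, rotate A (ξ.proj a) = ξ.proj a) (A : SO2) :
    ξ.rotAct A a = ξ.act a (ξ.isotropyRep a ha A) :=
  (ξ.exists_rep ha A).choose_spec

/-- The class of the isotropy representation at (any point above) a fixed point `x`. -/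
def isotropyClass [LieGroup 𝓘(ℝ, V) ∞ G] (x : S2) (hx : ∀ A, rotate A x = x) :
    RepClasses V G :=
  Quotient.mk _ (ξ.isotropyRep (ξ.exists_point x).choose
    (by rw [(ξ.exists_point x).choose_spec]; exact hx))

theorem isotropyClass_eq [LieGroup 𝓘(ℝ, V) ∞ G] (x : S2) (hx : ∀ A, rotate A x = x)
    (a : ξ.E) (ha : ξ.proj a = x) (α : SmoothHom V G)
    (hα : ∀ A, ξ.rotAct A a = ξ.act a (α A)) :
    ξ.isotropyClass x hx = Quotient.mk _ α := by
  apply Quotient.sound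
  set b := (ξ.exists_point x).choose with hb
  have hbx : ξ.proj b = x := (ξ.exists_point x).choose_spec
  obtain ⟨g, hg⟩ := ξ.exists_act_eq (hbx.trans ha.symm)
  refine ⟨g, fun A => ?_⟩
  have h := ξ.isotropyRep_spec b (by rw [hbx]; exact hx) A
  have h' : α A * g = g * ξ.isotropyRep b (by rw [hbx]; exact hx) A := by
    apply ξ.act_left_cancel (z := a)
    rw [ξ.act_mul, ← hα, ← ξ.rotAct_act, ← hg, h, ξ.act_mul, ← hg]
  exact eq_mul_inv_of_mul_eq h'

end EquivariantPrincipalBundle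

theorem isotropyClass_congr [LieGroup 𝓘(ℝ, V) ∞ G] {ξ ξ' : EquivariantPrincipalBundle V G}
    (H : Isomorphic ξ ξ') (x : S2) (hx : ∀ A, rotate A x = x) :
    ξ.isotropyClass x hx = ξ'.isotropyClass x hx := by
  obtain ⟨h, h1, h2, h3⟩ := H
  obtain ⟨a, ha⟩ := ξ.exists_point x
  have hax : ∀ A, rotate A (ξ.proj a) = ξ.proj a := by rw [ha]; exact hx
  rw [ξ.isotropyClass_eq x hx a ha _ (ξ.isotropyRep_spec a hax),
    ξ'.isotropyClass_eq x hx (h a) ((h3 a).trans ha) (ξ.isotropyRep a hax)]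
  intro A
  rw [← h2, ξ.isotropyRep_spec a hax, h1]

/-- The map `J`, sending the class of `ξ` to the classes of its isotropy representations at the
south pole and at the north pole, in this order. -/
def J [LieGroup 𝓘(ℝ, V) ∞ G] : BundleClasses V G → RepClasses V G × RepClasses V G :=
  Quotient.lift
    (fun ξ => (ξ.isotropyClass southPole rotate_southPole,
      ξ.isotropyClass northPole rotate_northPole))
    fun _ _ H => Prod.ext (isotropyClass_congr H _ rotate_southPole)
      (isotropyClass_congr H _ rotate_northPole)

/-- The standard parametrization `t ↦ exp(2πit)` of the circle. -/
def circleLoop (t : unitInterval) : Circle := Circle.exp (2 * Real.pi * t)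

theorem continuous_circleLoop : Continuous circleLoop := by
  unfold circleLoop; fun_prop

/-- The loop `z ↦ α(z) β(z)⁻¹` in `G`, where `z` runs through `S¹ ≅ SO(2)`. -/
def psiLoop [LieGroup 𝓘(ℝ, V) ∞ G] (α β : SmoothHom V G) : Path (1 : G) 1 where
  toFun t := α (rot (circleLoop t)) * (β (rot (circleLoop t)))⁻¹
  continuous_toFun :=
    haveI := topologicalGroup_of_lieGroup 𝓘(ℝ, V) ∞ (G := G)
    have h : Continuous fun t => rot (circleLoop t) :=
      rotHomeo.continuous.comp continuous_circleLoop
    ((map_continuous α).comp h).mul ((map_continuous β).comp h).inv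
  source' := by
    have h : rot (circleLoop 0) = 1 := by
      rw [show circleLoop 0 = 1 by simp [circleLoop]]; exact map_one rotEquiv
    rw [h, map_one, map_one, inv_one, mul_one]
  target' := by
    have h : rot (circleLoop 1) = 1 := by
      rw [show circleLoop 1 = 1 by simp [circleLoop]]; exact map_one rotEquiv
    rw [h, map_one, map_one, inv_one, mul_one]

/-- `ψ(α, β) = [z ↦ α(z) β(z)⁻¹] ∈ π₁(G, 1)`. -/
def psi [LieGroup 𝓘(ℝ, V) ∞ G] (α β : SmoothHom V G) : FundamentalGroup G 1 :=
  FundamentalGroup.fromPath (Path.Homotopic.Quotient.mk (psiLoop α β))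

/-- The closed unit disc. -/
abbrev Disc : Type := Metric.closedBall (0 : ℂ) 1

/-- The boundary circle of the disc. -/
def discBoundary (z : Circle) : Disc := ⟨z, mem_closedBall_zero_iff.2 z.norm_coe.le⟩

/-- The map `D² → S²`, `w ↦ (2 √(1 - |w|²) w, 1 - 2 |w|²)`, which collapses the boundary circle to
the south pole and is an orientation preserving homeomorphism of the open disc onto the complement
of the south pole (the sphere being oriented by the outward normal). It represents the class of
`id` in `π₂(S², southPole) = π₂(D²/∂D², *)`. -/
def collapse : C(Disc, S2) where
  toFun w := ⟨!₂[2 * √(1 - ‖w.1‖ ^ 2) * w.1.re, 2 * √(1 - ‖w.1‖ ^ 2) * w.1.im,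
      1 - 2 * ‖w.1‖ ^ 2], mem_S2 (by
    have h1 : ‖w.1‖ ≤ 1 := mem_closedBall_zero_iff.1 w.2
    have h2 : √(1 - ‖w.1‖ ^ 2) ^ 2 = 1 - ‖w.1‖ ^ 2 :=
      Real.sq_sqrt (by nlinarith [norm_nonneg w.1])
    have h3 : w.1.re ^ 2 + w.1.im ^ 2 = ‖w.1‖ ^ 2 := by
      rw [← Complex.normSq_eq_norm_sq, Complex.normSq_apply]; ring
    linear_combination 4 * (w.1.re ^ 2 + w.1.im ^ 2) * h2 + 4 * (1 - ‖w.1‖ ^ 2) * h3)⟩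
  continuous_toFun := by
    refine Continuous.subtype_mk ?_ _
    refine (PiLp.continuous_toLp 2 _).comp (continuous_pi fun i => ?_)
    fin_cases i <;> simp <;> fun_prop

/-- The boundary operator `∂ : π₂(S², x₀) → π₁(G)` of the homotopy exact sequence of a principal
bundle, on the class of a map `f : (D², S¹) → (S², x₀)`: one lifts `f` to a map `F : D² → E` with
`F(1) = a`; on the boundary circle `F` takes values in the fibre `a · G ≅ G`, which gives a loop
in `G` based at `1`. The set collects the values for all `a` above `x₀`; it is an orbit of the
action of `π₀(G)` on `π₁(G)` by conjugation. -/
def PrincipalBundle.boundary (η : PrincipalBundle V G) (f : C(Disc, S2)) :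
    Set (FundamentalGroup G 1) :=
  {c | ∃ (a : η.E) (F : C(Disc, η.E)) (γ : Path (1 : G) 1),
    (∀ w, η.proj (F w) = f w) ∧
    (∀ t, F (discBoundary (circleLoop t)) = η.act a (γ t)) ∧
    c = FundamentalGroup.fromPath (Path.Homotopic.Quotient.mk γ)}

/-- The class `C(η) = [∂(id)] ∈ π₁(G) / π₀(G)`, an orbit of the conjugation action of `π₀(G)`,
regarded as a subset of `π₁(G)`. -/
def PrincipalBundle.C (η : PrincipalBundle V G) : Set (FundamentalGroup G 1) :=
  η.boundary collapse

end Bundles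

end EquivariantBundle

end

open scoped Manifold ContDiff EuclideanGeometry

noncomputable section

namespace EquivariantBundle

open Set Filter Topology

/-! ### Smooth maps into spheres and into the circle. -/

section Sphere

variable {F : Type*} [NormedAddCommGroup F] [NormedSpace ℝ F] {H : Type*} [TopologicalSpace H]
  {I : ModelWithCorners ℝ F H} {M : Type*} [TopologicalSpace M] [ChartedSpace H M]

/-! The quotient of the sphere by the rotations is a meridian arc, so an equivariant bundle is
determined by what happens at the two poles, provided everything can be normalized along one
meridian. The normal form is a `Framing`: a smooth section over the complement of each pole,
satisfying A·s(x) = s(Ax)·γ(A) with γ the isotropy representation at its centre (α at the south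
pole, β at the north pole), such that the two sections agree on one meridian. Rotating the meridian
shows that the north section is the south section times α(z)β(z)⁻¹ at angle z (`Framing.s_neg`). The
transition function thus depends on α and β alone.

Every bundle has a framing (`exists_framing`). Near a pole, correcting an arbitrary section to an
equivariant one amounts to finding an invariant graph for a circle action on ℂ × G near a fixed
point. Averaging against the linearized action produces an equivariant map with invertible fibre
derivative, whose zero set is this graph (`exists_invariant_graph`). Along the meridian the two
local sections are joined by a smooth lift, which is possible because G is connected
(`exists_lift`). Rotating this lift extends the sections over the two charts
(`exists_equivariant_section_of_lift`).

Injectivity of `J`: bundles framed by the same pair of representations have the same transition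
function, so matching framings is an isomorphism (`Framing.isomorphic`). Surjectivity: α(z)β(z)⁻¹ is
used as a clutching function, and SO(2) acts on the fibre coordinate of each chart through the
representation at its centre (`Clutching.bundle`).

For the boundary class, the north section over the open disc, rewritten through the south section,
extends continuously to the boundary circle, where it traces α(z)β(z)⁻¹ (`Framing.discLift`). Two
lifts of the disc differ by a map of the disc to G, which contracts radially; connectedness of G
removes the remaining conjugation (`boundary_subsingleton`). -/

/-- A map into a sphere is smooth on a set if its composition with the inclusion is. -/
theorem contMDiffOn_sphere_of_coe {E : Type*} [NormedAddCommGroup E] [InnerProductSpace ℝ E]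
    {n : ℕ} [Fact (Module.finrank ℝ E = n + 1)] [IsManifold I ∞ M] {s : Set M}
    {f : M → Metric.sphere (0 : E) 1}
    (hf : ContMDiffOn I 𝓘(ℝ, E) ∞ (fun x => (f x : E)) s) : ContMDiffOn I (𝓡 n) ∞ f s := by
  rw [contMDiffOn_iff_target]
  refine ⟨continuousOn_iff_continuous_domRestrict.2
    (continuous_induced_rng.2 (continuousOn_iff_continuous_domRestrict.1 hf.continuousOn)), ?_⟩
  intro v
  let U : _ ≃ₗᵢ[ℝ] _ :=
    (OrthonormalBasis.fromOrthogonalSpanSingleton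
        n (ne_zero_of_mem_unit_sphere (-v))).repr
  have h : ContDiffOn ℝ ω _ Set.univ := U.contDiff.contDiffOn
  have H₁ := (h.comp_inter contDiffOn_stereoToFun).contMDiffOn
  convert! (H₁.of_le le_top).comp' hf using 1
  ext x
  -- The chart at `v` projects from `-v`. For unit vectors, avoiding `-v` is the condition `inner ≠
  -- 1` under which the ambient formula for the projection is smooth.
  have hfxv : (f x : E) = -↑v ↔ inner ℝ (f x : E) (-(v : E)) = 1 := by
    have hfx : ‖(f x : E)‖ = 1 := by simp
    rw [inner_eq_one_iff_of_norm_eq_one hfx]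
    exact norm_eq_of_mem_sphere (-v)
  simp [chartAt, ChartedSpace.chartAt, Subtype.ext_iff, hfxv, real_inner_comm]

theorem finrank_euclideanSpace_three :
    Fact (Module.finrank ℝ (EuclideanSpace ℝ (Fin 3)) = 2 + 1) := ⟨by simp⟩

theorem contMDiffOn_S2_of_coord [IsManifold I ∞ M] {s : Set M} {f : M → S2}
    (hf : ∀ i, ContMDiffOn I 𝓘(ℝ, ℝ) ∞ (fun x => (f x).1 i) s) : ContMDiffOn I (𝓡 2) ∞ f s := by
  have := finrank_euclideanSpace_three
  apply contMDiffOn_sphere_of_coe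
  have h : ContMDiffOn I 𝓘(ℝ, Fin 3 → ℝ) ∞ (fun x i => (f x).1 i) s :=
    contMDiffOn_pi_space.2 hf
  exact ((EuclideanSpace.equiv (Fin 3) ℝ).symm.contDiff.contMDiff.comp_contMDiffOn h)

theorem contMDiff_S2_coord (i : Fin 3) : ContMDiff (𝓡 2) 𝓘(ℝ, ℝ) ∞ fun x : S2 => x.1 i :=
  haveI := finrank_euclideanSpace_three
  (EuclideanSpace.proj (𝕜 := ℝ) i).contDiff.contMDiff.comp contMDiff_coe_sphere

theorem contMDiffOn_circle_of_coe [IsManifold I ∞ M] {s : Set M} {f : M → Circle}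
    (hf : ContMDiffOn I 𝓘(ℝ, ℂ) ∞ (fun x => (f x : ℂ)) s) : ContMDiffOn I (𝓡 1) ∞ f s :=
  haveI := finrank_real_complex_fact'
  contMDiffOn_sphere_of_coe (E := ℂ) (n := 1) hf

theorem contMDiff_circle_coe : ContMDiff (𝓡 1) 𝓘(ℝ, ℂ) ∞ fun z : Circle => (z : ℂ) :=
  haveI := finrank_real_complex_fact'
  contMDiff_coe_sphere (E := ℂ) (n := 1)

end Sphere

/-! ### Smoothness of the rotation action. -/

theorem contMDiff_rot : ContMDiff (𝓡 1) (𝓡 1) ∞ rot := contMDiff_rotHomeo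

theorem rot_mul (z w : Circle) : rot (z * w) = rot z * rot w := rotEquiv.map_mul z w

theorem rot_one : rot 1 = 1 := map_one rotEquiv

theorem rot_surjective : Function.Surjective rot := rotEquiv.surjective

theorem contMDiff_SO2_entry (i j : Fin 2) : ContMDiff (𝓡 1) 𝓘(ℝ, ℝ) ∞ fun A : SO2 => A.1 i j := by
  have h := contMDiff_circle_coe.comp contMDiff_rotHomeo_symm
  have hre := Complex.reCLM.contDiff.contMDiff.comp h
  have him := Complex.imCLM.contDiff.contMDiff.comp h
  have h0 : ∀ A : SO2, A.1 0 0 = A.1 1 1 ∧ A.1 0 1 = -A.1 1 0 := fun A =>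
    ⟨A.entries.1, A.entries.2.1⟩
  fin_cases i <;> fin_cases j
  · exact hre
  · simp only [Fin.zero_eta, Fin.mk_one, (h0 _).2]
    exact him.neg
  · exact him
  · simp only [Fin.mk_one, ← (h0 _).1]
    exact hre

theorem contMDiff_rotate :
    ContMDiff ((𝓡 1).prod (𝓡 2)) (𝓡 2) ∞ fun q : SO2 × S2 => rotate q.1 q.2 := by
  rw [← contMDiffOn_univ]
  apply contMDiffOn_S2_of_coord
  have hA : ∀ i j, ContMDiff ((𝓡 1).prod (𝓡 2)) 𝓘(ℝ, ℝ) ∞ fun q : SO2 × S2 => q.1.1 i j :=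
    fun i j => (contMDiff_SO2_entry i j).comp contMDiff_fst
  have hx : ∀ i, ContMDiff ((𝓡 1).prod (𝓡 2)) 𝓘(ℝ, ℝ) ∞ fun q : SO2 × S2 => q.2.1 i :=
    fun i => (contMDiff_S2_coord i).comp contMDiff_snd
  intro i
  rw [contMDiffOn_univ]
  fin_cases i
  · exact ((hA 0 0).mul (hx 0)).add ((hA 0 1).mul (hx 1))
  · exact ((hA 1 0).mul (hx 0)).add ((hA 1 1).mul (hx 1))
  · exact hx 2

theorem rotate_one (x : S2) : rotate 1 x = x := by
  apply Subtype.ext; ext i; fin_cases i <;> simp [rotate]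

theorem rotate_mul (A B : SO2) (x : S2) : rotate (A * B) x = rotate A (rotate B x) := by
  apply Subtype.ext
  ext i
  fin_cases i <;> simp [rotate, Matrix.mul_apply, Fin.sum_univ_two] <;> ring

/-! ### Stereographic coordinates -/

/-- A sign, as a real number. -/
def sgn (ε : ℤˣ) : ℝ := ((ε : ℤ) : ℝ)

theorem sgn_sq (ε : ℤˣ) : sgn ε ^ 2 = 1 := by
  rcases Int.units_eq_one_or ε with rfl | rfl <;> simp [sgn]

theorem sgn_neg (ε : ℤˣ) : sgn (-ε) = -sgn ε := by simp [sgn]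

theorem sgn_one : sgn 1 = 1 := by simp [sgn]

theorem sgn_ne_zero (ε : ℤˣ) : sgn ε ≠ 0 := by
  intro h; simpa [h] using sgn_sq ε

/-- The pole `(0, 0, ε)`. -/
def pole (ε : ℤˣ) : S2 := ⟨!₂[0, 0, sgn ε], mem_S2 (by simp [sgn_sq])⟩

theorem pole_one : pole 1 = northPole := by simp [pole, northPole, sgn]

theorem pole_neg_one : pole (-1) = southPole := by simp [pole, southPole, sgn]

theorem eq_pole_iff {x : S2} {ε : ℤˣ} : x = pole ε ↔ x.1 2 = sgn ε := by
  refine ⟨fun h => by simp [h, pole], fun h => ?_⟩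
  have h2 := x.sq_sum
  rw [h, sgn_sq] at h2
  have h0 : x.1 0 = 0 := by nlinarith [sq_nonneg (x.1 0), sq_nonneg (x.1 1)]
  have h1 : x.1 1 = 0 := by nlinarith [sq_nonneg (x.1 0), sq_nonneg (x.1 1)]
  apply Subtype.ext; ext i; fin_cases i <;> simp [pole, h0, h1, h]

theorem pole_ne_neg (ε : ℤˣ) : pole ε ≠ pole (-ε) := by
  rw [Ne, eq_pole_iff, sgn_neg]
  intro h
  have h' : sgn ε = -sgn ε := by simpa [pole] using h
  exact sgn_ne_zero ε (by linarith)

/-- Inverse stereographic projection, centred at the pole `ε`. -/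
def stereo (ε : ℤˣ) (x : ℂ) : S2 :=
  ⟨!₂[2 * x.re / (1 + Complex.normSq x), 2 * x.im / (1 + Complex.normSq x),
    sgn ε * (1 - Complex.normSq x) / (1 + Complex.normSq x)], mem_S2 (by
      have h : 1 + Complex.normSq x ≠ 0 := by linarith [Complex.normSq_nonneg x]
      have h' : Complex.normSq x = x.re ^ 2 + x.im ^ 2 := by rw [Complex.normSq_apply]; ring
      field_simp
      rw [sgn_sq, h']
      ring)⟩

/-- Stereographic projection, centred at the pole `ε`. -/
def coord (ε : ℤˣ) (x : S2) : ℂ := ⟨x.1 0 / (1 + sgn ε * x.1 2), x.1 1 / (1 + sgn ε * x.1 2)⟩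

theorem one_add_normSq_ne (x : ℂ) : 1 + Complex.normSq x ≠ 0 := by
  linarith [Complex.normSq_nonneg x]

theorem contDiff_normSq : ContDiff ℝ ∞ (fun x : ℂ => Complex.normSq x) := by
  simp only [Complex.normSq_apply]
  have hre : ContDiff ℝ ∞ (fun x : ℂ => x.re) := Complex.reCLM.contDiff
  have him : ContDiff ℝ ∞ (fun x : ℂ => x.im) := Complex.imCLM.contDiff
  exact (hre.mul hre).add (him.mul him)

theorem contMDiff_stereo (ε : ℤˣ) : ContMDiff 𝓘(ℝ, ℂ) (𝓡 2) ∞ (stereo ε) := by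
  rw [← contMDiffOn_univ]
  apply contMDiffOn_S2_of_coord
  intro i
  rw [contMDiffOn_univ]
  apply ContDiff.contMDiff
  have hre : ContDiff ℝ ∞ (fun x : ℂ => x.re) := Complex.reCLM.contDiff
  have him : ContDiff ℝ ∞ (fun x : ℂ => x.im) := Complex.imCLM.contDiff
  have hn := contDiff_normSq
  have hd : ContDiff ℝ ∞ (fun x : ℂ => 1 + Complex.normSq x) := contDiff_const.add hn
  fin_cases i
  · exact (contDiff_const.mul hre).div hd one_add_normSq_ne
  · exact (contDiff_const.mul him).div hd one_add_normSq_ne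
  · exact (contDiff_const.mul (contDiff_const.sub hn)).div hd one_add_normSq_ne

theorem one_add_sgn_mul_ne {ε : ℤˣ} {x : S2} (h : x ≠ pole (-ε)) : 1 + sgn ε * x.1 2 ≠ 0 := by
  rw [Ne, eq_pole_iff, sgn_neg] at h
  intro h'
  apply h
  linear_combination sgn ε * h' - x.1 2 * sgn_sq ε

theorem contMDiffOn_coord (ε : ℤˣ) : ContMDiffOn (𝓡 2) 𝓘(ℝ, ℂ) ∞ (coord ε) {pole (-ε)}ᶜ := by
  have hd : ContMDiffOn (𝓡 2) 𝓘(ℝ, ℝ) ∞ (fun x : S2 => 1 + sgn ε * x.1 2) {pole (-ε)}ᶜ :=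
    (contMDiff_const.add (contMDiff_const.mul (contMDiff_S2_coord 2))).contMDiffOn
  have hd' : ContMDiffOn (𝓡 2) 𝓘(ℝ, ℝ) ∞ (fun x : S2 => (1 + sgn ε * x.1 2)⁻¹) {pole (-ε)}ᶜ :=
    hd.inv₀ fun x hx => one_add_sgn_mul_ne hx
  have h0 := (contMDiff_S2_coord 0).contMDiffOn.mul hd'
  have h1 := (contMDiff_S2_coord 1).contMDiffOn.mul hd'
  have h := Complex.equivRealProdCLM.symm.contDiff (n := ∞) |>.contMDiff.comp_contMDiffOn
    (h0.prodMk_space h1)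
  refine h.congr fun x _ => ?_
  apply Complex.ext <;> simp [coord, div_eq_mul_inv]

theorem coord_stereo (ε : ℤˣ) (x : ℂ) : coord ε (stereo ε x) = x := by
  have h := one_add_normSq_ne x
  have h1 : 1 + sgn ε * (sgn ε * (1 - Complex.normSq x) / (1 + Complex.normSq x)) =
      2 / (1 + Complex.normSq x) := by
    field_simp
    linear_combination (1 - Complex.normSq x) * sgn_sq ε
  apply Complex.ext <;> simp [coord, stereo, h1] <;> field_simp

theorem stereo_coord {ε : ℤˣ} {x : S2} (hx : x ≠ pole (-ε)) : stereo ε (coord ε x) = x := by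
  have h := one_add_sgn_mul_ne hx
  have hs := sgn_sq ε
  have hn : Complex.normSq (coord ε x) * (1 + sgn ε * x.1 2) = 1 - sgn ε * x.1 2 := by
    simp only [coord, Complex.normSq_mk]
    field_simp
    linear_combination x.sq_sum + x.1 2 ^ 2 * hs
  have h2 := one_add_normSq_ne (coord ε x)
  have h3 : (1 + Complex.normSq (coord ε x)) * (1 + sgn ε * x.1 2) = 2 := by
    linear_combination hn
  have h4 : 1 + Complex.normSq (coord ε x) = 2 / (1 + sgn ε * x.1 2) := by
    field_simp; linear_combination h3
  have h5 : 1 - Complex.normSq (coord ε x) = 2 * sgn ε * x.1 2 / (1 + sgn ε * x.1 2) := by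
    field_simp; linear_combination -hn
  apply Subtype.ext
  ext i
  fin_cases i
  · simp only [stereo, h4]; simp [coord]; field_simp
  · simp only [stereo, h4]; simp [coord]; field_simp
  · simp only [stereo, h4, h5]; simp; field_simp; linear_combination x.1 2 * hs

theorem stereo_zero (ε : ℤˣ) : stereo ε 0 = pole ε := by
  simp [stereo, pole]

theorem stereo_ne (ε : ℤˣ) (x : ℂ) : stereo ε x ≠ pole (-ε) := by
  rw [Ne, eq_pole_iff, sgn_neg]
  intro h
  have h1 : sgn ε * (1 - Complex.normSq x) / (1 + Complex.normSq x) = -sgn ε := h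
  have h2 := one_add_normSq_ne x
  field_simp at h1
  have : sgn ε * 2 = 0 := by linear_combination h1
  exact sgn_ne_zero ε (by linarith)

/-- Both charts use the first two coordinates in the same order, so a rotation is multiplication by
z, not z⁻¹, at either pole. The price is that the chart change reverses orientation. -/
theorem rotate_stereo (z : Circle) (ε : ℤˣ) (x : ℂ) :
    rotate (rot z) (stereo ε x) = stereo ε (z * x) := by
  have h : Complex.normSq (z * x) = Complex.normSq x := by simp
  apply Subtype.ext
  ext i
  fin_cases i
  · simp [rotate, stereo, rot]; ring
  · simp [rotate, stereo, rot]; ring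
  · simp [rotate, stereo]

/-- In polar coordinates the chart change keeps the angle and inverts the radius. With radius `exp
t`, each ray is a meridian parametrized by the whole line, and exchanging the poles is `t ↦ -t`. -/
theorem stereo_neg_exp (ε : ℤˣ) (z : Circle) (t : ℝ) :
    stereo (-ε) (z * Real.exp t) = stereo ε (z * Real.exp (-t)) := by
  have h1 : Complex.normSq (Real.exp t : ℂ) = Real.exp t ^ 2 := by
    rw [Complex.normSq_ofReal]; ring
  have h2 : Complex.normSq (Real.exp (-t) : ℂ) = (Real.exp t ^ 2)⁻¹ := by
    rw [Complex.normSq_ofReal, Real.exp_neg, sq, mul_inv]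
  have h3 := Real.exp_pos t
  rw [← rotate_stereo, ← rotate_stereo]
  congr 1
  apply Subtype.ext
  ext i
  fin_cases i
  · simp only [stereo, h1, h2, Complex.ofReal_re]
    simp only [Real.exp_neg]
    simp
    field_simp
    ring
  · simp only [stereo, h1, h2, Complex.ofReal_im]; simp
  · simp only [stereo, h1, h2, sgn_neg]; simp; field_simp; ring

/-- The angle of a complex number (with the value `1` at `0`). -/
def ang (x : ℂ) : Circle :=
  if h : x = 0 then 1 else ⟨x / ‖x‖, by
    rw [Submonoid.unitSphere, ← SetLike.mem_coe]
    simp [h]⟩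

theorem ang_coe {x : ℂ} (h : x ≠ 0) : (ang x : ℂ) = x / ‖x‖ := by simp [ang, h]

theorem ang_mul_norm {x : ℂ} (h : x ≠ 0) : (ang x : ℂ) * ‖x‖ = x := by
  rw [ang_coe h, div_mul_cancel₀]
  simpa using h

theorem ang_circle_mul (z : Circle) {x : ℂ} (h : x ≠ 0) : ang (z * x) = z * ang x := by
  ext
  rw [Circle.coe_mul, ang_coe h, ang_coe (by simp [h])]
  rw [norm_mul, Circle.norm_coe, one_mul, mul_div_assoc]

theorem ang_ofReal {r : ℝ} (h : 0 < r) : ang r = 1 := by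
  ext
  rw [ang_coe (by simpa using h.ne')]
  simp [abs_of_pos h, h.ne']

theorem contMDiffOn_ang : ContMDiffOn 𝓘(ℝ, ℂ) (𝓡 1) ∞ ang {0}ᶜ := by
  apply contMDiffOn_circle_of_coe
  have h : ContDiffOn ℝ ∞ (fun x : ℂ => x / ‖x‖) {0}ᶜ := by
    have hn : ContDiffOn ℝ ∞ (fun x : ℂ => ‖x‖) {0}ᶜ := contDiffOn_id.norm ℝ fun x hx => hx
    have hn' := Complex.ofRealCLM.contDiff (n := ∞) |>.comp_contDiffOn hn
    have hn'' : ContDiffOn ℝ ∞ (fun x : ℂ => ((‖x‖ : ℝ) : ℂ)⁻¹) {0}ᶜ :=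
      ContDiffOn.inv hn' fun x hx => by simpa using hx
    simp only [div_eq_mul_inv]
    exact contDiffOn_id.mul hn''
  exact h.contMDiffOn.congr fun x hx => ang_coe hx

theorem coord_pole (ε : ℤˣ) : coord ε (pole ε) = 0 := by rw [← stereo_zero, coord_stereo]

/-! ### Averaging over the circle -/

section Analysis

open MeasureTheory

variable {P : Type*} [NormedAddCommGroup P] [NormedSpace ℝ P]
  {W : Type*} [NormedAddCommGroup W] [NormedSpace ℝ W]

/-- An integral over a bounded interval is a smooth function of parameters. -/
theorem contDiffOn_intervalIntegral_param [CompleteSpace W] {s : Set P} (hs : IsOpen s)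
    {F : P → ℝ → W}
    (hF : ContDiffOn ℝ ∞ (fun q : P × ℝ => F q.1 q.2) (s ×ˢ univ)) {a b : ℝ} (hab : a ≤ b) :
    ContDiffOn ℝ ∞ (fun p => ∫ t in a..b, F p t) s := by
  -- The integral is the value at 0 of the convolution of the indicator of (a, b] with a cut-off of
  -- `F`. Convolution evaluates the second factor at 0 - t, whence the signs: the bump is 1 on [-b,
  -- -a].
  let η : ContDiffBump (-((a + b) / 2)) :=
    ⟨(b - a) / 2 + 1, (b - a) / 2 + 2, by linarith, by linarith⟩
  let g : P → ℝ → W := fun p x => η x • F p (-x)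
  have hg : ContDiffOn ℝ ∞ (fun q : P × ℝ => g q.1 q.2) (s ×ˢ univ) := by
    refine ContDiffOn.smul (η.contDiff.comp contDiff_snd).contDiffOn ?_
    refine hF.comp (contDiff_fst.prodMk contDiff_snd.neg).contDiffOn ?_
    rintro ⟨p, t⟩ ⟨hp, -⟩
    exact ⟨hp, mem_univ _⟩
  have hf : LocallyIntegrable (indicator (Ioc a b) fun _ => (1 : ℝ)) (volume : Measure ℝ) := by
    refine Integrable.locallyIntegrable ?_
    rw [integrable_indicator_iff measurableSet_Ioc]
    exact integrableOn_const (by simp)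
  have hgs : ∀ p, ∀ x, p ∈ s → x ∉ tsupport η → g p x = 0 := fun p x _ hx => by
    simp [g, image_eq_zero_of_notMem_tsupport hx]
  have h := (contDiffOn_convolution_right_with_param (n := ⊤) (ContinuousLinearMap.lsmul ℝ ℝ)
    hs η.hasCompactSupport hgs hf hg).comp (contDiff_id.prodMk contDiff_const).contDiffOn
    (s := s) (f := fun p => (p, (0 : ℝ))) fun p hp => ⟨hp, mem_univ _⟩
  refine h.congr fun p _ => ?_
  simp only [Function.comp, convolution, ContinuousLinearMap.lsmul_apply, g, zero_sub, neg_neg]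
  rw [intervalIntegral.integral_of_le hab, ← integral_indicator measurableSet_Ioc]
  congr 1
  funext t
  by_cases ht : t ∈ Ioc a b
  · have hη : η (-t) = 1 := by
      apply η.one_of_mem_closedBall
      have hr : η.rIn = (b - a) / 2 + 1 := rfl
      rw [mem_closedBall_iff_norm, Real.norm_eq_abs, abs_le, hr]
      constructor <;> linarith [ht.1, ht.2]
    simp [ht, hη]
  · simp [ht]

/-- Dominated differentiation: the dominating constant is the maximum of the partial derivative over
a closed ball times the interval, compact because `P` is finite dimensional. -/
theorem hasFDerivAt_intervalIntegral_param [CompleteSpace W] [FiniteDimensional ℝ P]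
    {s : Set P} (hs : IsOpen s)
    {F : P → ℝ → W} (hF : ContDiffOn ℝ ∞ (fun q : P × ℝ => F q.1 q.2) (s ×ˢ univ)) (a b : ℝ)
    {p₀ : P} (hp₀ : p₀ ∈ s) :
    HasFDerivAt (fun p => ∫ t in a..b, F p t)
      (∫ t in a..b, fderiv ℝ (fun p => F p t) p₀) p₀ := by
  have hopen : IsOpen (s ×ˢ (univ : Set ℝ)) := hs.prod isOpen_univ
  let F' : P × ℝ → P →L[ℝ] W := fun q =>
    (fderiv ℝ (fun q : P × ℝ => F q.1 q.2) q).comp (ContinuousLinearMap.inl ℝ P ℝ)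
  have hF' : ContinuousOn F' (s ×ˢ univ) :=
    (hF.continuousOn_fderiv_of_isOpen hopen (by simp)).clm_comp continuousOn_const
  have hd : ∀ p ∈ s, ∀ t, HasFDerivAt (fun p => F p t) (F' (p, t)) p := fun p hp t => by
    have h1 := ((hF.contDiffAt (hopen.mem_nhds (mk_mem_prod hp (mem_univ t)))).differentiableAt
      (by simp)).hasFDerivAt
    exact HasFDerivAt.comp (f := fun p => (p, t)) p h1 (hasFDerivAt_prodMk_left p t)
  obtain ⟨δ, hδ, hball⟩ := Metric.isOpen_iff.1 hs p₀ hp₀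
  have hcb : Metric.closedBall p₀ (δ / 2) ⊆ s :=
    (Metric.closedBall_subset_ball (by linarith)).trans hball
  have hK : IsCompact (Metric.closedBall p₀ (δ / 2) ×ˢ uIcc a b) :=
    (isCompact_closedBall _ _).prod isCompact_uIcc
  obtain ⟨C, hC⟩ := hK.exists_bound_of_continuousOn
    (hF'.mono (prod_mono hcb (subset_univ _)))
  have hFt : ∀ p ∈ s, Continuous (F p) := fun p hp =>
    hF.continuousOn.comp_continuous (f := fun t => (p, t)) (by fun_prop) fun t => ⟨hp, mem_univ _⟩
  have hF't : Continuous fun t => F' (p₀, t) :=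
    hF'.comp_continuous (f := fun t => (p₀, t)) (by fun_prop) fun t => ⟨hp₀, mem_univ _⟩
  have key := intervalIntegral.hasFDerivAt_integral_of_dominated_of_fderiv_le
    (μ := volume) (a := a) (b := b) (F := F) (F' := fun p t => F' (p, t)) (x₀ := p₀)
    (bound := fun _ => C) (s := Metric.closedBall p₀ (δ / 2))
    (Metric.closedBall_mem_nhds _ (by linarith))
    (by filter_upwards [hs.mem_nhds hp₀] with p hp
        exact (hFt p hp).aestronglyMeasurable)
    ((hFt p₀ hp₀).intervalIntegrable _ _) hF't.aestronglyMeasurable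
    (Eventually.of_forall fun t ht p hp => hC (p, t) ⟨hp, uIoc_subset_uIcc ht⟩)
    intervalIntegrable_const
    (Eventually.of_forall fun t _ p hp => hd p (hcb hp) t)
  have h : ∀ t, fderiv ℝ (fun p => F p t) p₀ = F' (p₀, t) := fun t => (hd p₀ hp₀ t).fderiv
  simpa only [h] using key

/-- The implicit function theorem, with smoothness on a neighbourhood. -/
theorem exists_contDiff_implicitFunction [CompleteSpace P] [CompleteSpace W] {O : Set (P × W)}
    (hO : IsOpen O) {L : P × W → W} (hL : ContDiffOn ℝ ∞ L O) {u : P × W} (hu : u ∈ O)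
    (hinv : (fderiv ℝ L u ∘L .inr ℝ P W).IsInvertible) :
    ∃ ψ : P → W, ψ u.1 = u.2 ∧ (∀ᶠ x in 𝓝 u.1, ContDiffAt ℝ ∞ ψ x) ∧
      ∀ᶠ v in 𝓝 u, L v = L u ↔ ψ v.1 = v.2 := by
  have hne : (∞ : ℕ∞ω) ≠ 0 := by simp
  have hat : ∀ v ∈ O, ContDiffAt ℝ ∞ L v := fun v hv => hL.contDiffAt (hO.mem_nhds hv)
  let ψ := (hat u hu).implicitFunction hne hinv
  have h1 : ψ u.1 = u.2 := (hat u hu).implicitFunction_apply_self hne hinv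
  have h2 : ∀ᶠ v in 𝓝 u, L v = L u ↔ ψ v.1 = v.2 :=
    (hat u hu).eventually_apply_eq_iff_implicitFunction hne hinv
  have h3 : ContDiffAt ℝ 1 ψ u.1 :=
    ((hat u hu).contDiffAt_implicitFunction hne hinv).of_le (by simp)
  refine ⟨ψ, h1, ?_, h2⟩
  have hfd : ContinuousAt (fun v => fderiv ℝ L v ∘L .inr ℝ P W) u :=
    ((hL.continuousOn_fderiv_of_isOpen hO (by simp)).continuousAt
      (hO.mem_nhds hu)).clm_comp continuousAt_const
  have h4 : ∀ᶠ v in 𝓝 u, (fderiv ℝ L v ∘L .inr ℝ P W).IsInvertible :=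
    hfd.eventually (ContinuousLinearEquiv.isOpen.mem_nhds hinv)
  -- Being C^∞ at one point only gives, for each finite order, a neighbourhood depending on that
  -- order. So the theorem is applied again at each nearby point (x, ψ x) of the zero level; local
  -- uniqueness identifies the new implicit function with ψ near x.
  have h5 : ∀ᶠ v in 𝓝 u, v ∈ O ∧ (fderiv ℝ L v ∘L .inr ℝ P W).IsInvertible ∧
      (∀ᶠ v' in 𝓝 v, L v' = L u ↔ ψ v'.1 = v'.2) :=
    Eventually.and (hO.mem_nhds hu) (h4.and h2.eventually_nhds)
  have hcont : ContinuousAt (fun x => (x, ψ x)) u.1 :=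
    continuousAt_id.prodMk h3.continuousAt
  have h6 := hcont.eventually (p := fun v => v ∈ O ∧ (fderiv ℝ L v ∘L .inr ℝ P W).IsInvertible ∧
      (∀ᶠ v' in 𝓝 v, L v' = L u ↔ ψ v'.1 = v'.2)) (by simpa only [h1] using h5)
  filter_upwards [h6] with x hx
  obtain ⟨hxO, hxi, hxe⟩ := hx
  have hLx : L (x, ψ x) = L u := hxe.self_of_nhds.2 rfl
  have hd := (hat _ hxO).contDiffAt_implicitFunction hne hxi
  refine hd.congr_of_eventuallyEq ?_
  have hc : ContinuousAt (fun y => (y, (hat _ hxO).implicitFunction hne hxi y)) x :=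
    continuousAt_id.prodMk hd.continuousAt
  have hself : (hat _ hxO).implicitFunction hne hxi x = ψ x :=
    (hat _ hxO).implicitFunction_apply_self hne hxi
  have h7 := hc.eventually (p := fun v' => L v' = L u ↔ ψ v'.1 = v'.2)
    (by simpa only [hself] using hxe)
  filter_upwards [h7, (hat _ hxO).eventually_apply_implicitFunction hne hxi] with y hy hy'
  exact hy.1 (hy'.trans hLx)

variable {V : Type*} [NormedAddCommGroup V] [NormedSpace ℝ V] [FiniteDimensional ℝ V]

/-- A local action of the circle on `ℂ × V` over the rotations of `ℂ`, with a fixed point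
`(0, v₀)`, has an invariant smooth graph through this point. -/
theorem exists_invariant_graph {M : ℝ → ℂ × V → V} {O : Set (ℂ × V)} (hO : IsOpen O) {v₀ : V}
    (h0 : (0, v₀) ∈ O) (hM : ContDiffOn ℝ ∞ (fun q : (ℂ × V) × ℝ => M q.2 q.1) (O ×ˢ univ))
    (hper : ∀ p ∈ O, ∀ t, M (t + 2 * Real.pi) p = M t p) (hfix : ∀ t, M t (0, v₀) = v₀)
    (hzero : ∀ p ∈ O, M 0 p = p.2)
    (hadd : ∀ p ∈ O, ∀ s t, ((Circle.exp t : ℂ) * p.1, M t p) ∈ O →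
      M s ((Circle.exp t : ℂ) * p.1, M t p) = M (s + t) p) :
    ∃ δ > 0, ∃ u : ℂ → V, ContDiffOn ℝ ∞ u (Metric.ball 0 δ) ∧ u 0 = v₀ ∧
      ∀ x ∈ Metric.ball (0 : ℂ) δ, (x, u x) ∈ O ∧
        ∀ t, M t (x, u x) = u ((Circle.exp t : ℂ) * x) := by
  have : CompleteSpace V := FiniteDimensional.complete ℝ V
  have hopen : IsOpen (O ×ˢ (univ : Set ℝ)) := hO.prod isOpen_univ
  have hMt : ∀ t, ∀ p ∈ O, ContDiffAt ℝ ∞ (M t) p := fun t p hp =>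
    (hM.contDiffAt (hopen.mem_nhds ⟨hp, mem_univ t⟩)).comp p
      (f := fun p => (p, t)) (contDiffAt_id.prodMk contDiffAt_const)
  -- the linearized action
  let ρ : ℝ → V →L[ℝ] V := fun t => fderiv ℝ (fun v => M t (0, v)) v₀
  have hd : ∀ t, HasFDerivAt (fun v => M t (0, v)) (fderiv ℝ (M t) (0, v₀) ∘L .inr ℝ ℂ V) v₀ :=
    fun t => (((hMt t _ h0).differentiableAt (by simp)).hasFDerivAt).comp v₀
      (hasFDerivAt_prodMk_right 0 v₀)
  have hρ' : ∀ t, ρ t = fderiv ℝ (M t) (0, v₀) ∘L .inr ℝ ℂ V := fun t => (hd t).fderiv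
  have hnear : ∀ᶠ v in 𝓝 v₀, ((0 : ℂ), v) ∈ O :=
    (Continuous.prodMk_right (0 : ℂ)).continuousAt.eventually (hO.mem_nhds h0)
  have hρper : ∀ t, ρ (t + 2 * Real.pi) = ρ t := fun t => by
    refine Filter.EventuallyEq.fderiv_eq ?_
    filter_upwards [hnear] with v hv using hper _ hv t
  have hρzero : ρ 0 = ContinuousLinearMap.id ℝ V := by
    have : (fun v => M 0 (0, v)) =ᶠ[𝓝 v₀] id := by
      filter_upwards [hnear] with v hv using hzero _ hv
    exact this.fderiv_eq.trans fderiv_id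
  -- Chain rule at the common fixed point: `ρ` is a representation of the circle on V.
  have hρadd : ∀ s t, ρ (s + t) = (ρ s).comp (ρ t) := fun s t => by
    have hc : ∀ᶠ v in 𝓝 v₀, ((0 : ℂ), M t (0, v)) ∈ O := by
      have : ContinuousAt (fun v => ((0 : ℂ), M t (0, v))) v₀ :=
        continuousAt_const.prodMk (hd t).continuousAt
      exact this.eventually (hO.mem_nhds (by simpa only [hfix] using h0))
    have he : (fun v => M (s + t) (0, v)) =ᶠ[𝓝 v₀] fun v => M s (0, M t (0, v)) := by
      filter_upwards [hnear, hc] with v hv hv'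
      have h := hadd (0, v) hv s t (by simpa using hv')
      simpa using h.symm
    have hcomp : HasFDerivAt (fun v => M s (0, M t (0, v))) ((ρ s).comp (ρ t)) v₀ := by
      have h1 : HasFDerivAt (fun v => M s (0, v)) (ρ s) (M t (0, v₀)) := by
        rw [hfix, hρ']; exact hd s
      have h2 : HasFDerivAt (fun v => M t (0, v)) (ρ t) v₀ := by rw [hρ']; exact hd t
      exact h1.comp v₀ h2
    exact he.fderiv_eq.trans hcomp.fderiv
  have hρsm : ContDiff ℝ ∞ ρ := by
    have h1 : ContDiffOn ℝ ∞ (fderiv ℝ fun q : (ℂ × V) × ℝ => M q.2 q.1) (O ×ˢ univ) :=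
      hM.fderiv_of_isOpen hopen (by simp)
    have h2 : ContDiff ℝ ∞ fun t : ℝ =>
        fderiv ℝ (fun q : (ℂ × V) × ℝ => M q.2 q.1) ((0, v₀), t) :=
      h1.comp_contDiff (contDiff_const.prodMk contDiff_id) fun t => ⟨h0, mem_univ _⟩
    have h3 : ρ = fun t => (fderiv ℝ (fun q : (ℂ × V) × ℝ => M q.2 q.1) ((0, v₀), t)).comp
        ((ContinuousLinearMap.inl ℝ (ℂ × V) ℝ).comp (ContinuousLinearMap.inr ℝ ℂ V)) := by
      funext t
      have h4 := ((hM.contDiffAt (hopen.mem_nhds (mk_mem_prod h0 (mem_univ t)))).differentiableAt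
        (by simp)).hasFDerivAt
      have h5 : HasFDerivAt (fun v : V => (((0 : ℂ), v), t))
          ((ContinuousLinearMap.inl ℝ (ℂ × V) ℝ).comp (ContinuousLinearMap.inr ℝ ℂ V)) v₀ :=
        HasFDerivAt.comp (g := fun p : ℂ × V => (p, t)) (f := fun v : V => ((0 : ℂ), v)) v₀
          (hasFDerivAt_prodMk_left ((0 : ℂ), v₀) t) (hasFDerivAt_prodMk_right (0 : ℂ) v₀)
      exact (h4.comp v₀ h5).fderiv
    rw [h3]
    exact h2.clm_comp contDiff_const
  -- the averaged function
  let F : ℂ × V → ℝ → V := fun p t => ρ (-t) (M t p - v₀)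
  have hF : ContDiffOn ℝ ∞ (fun q : (ℂ × V) × ℝ => F q.1 q.2) (O ×ˢ univ) :=
    (hρsm.comp contDiff_snd.neg).contDiffOn.clm_apply (hM.sub contDiffOn_const)
  -- Bochner averaging: `L` satisfies L(s·p) = ρ(s) L(p) wherever both sides make sense, and its
  -- derivative along V at the fixed point is 2π·id. Its zero set is therefore invariant, and
  -- locally it is a graph over ℂ.
  let L : ℂ × V → V := fun p => ∫ t in (0 : ℝ)..2 * Real.pi, F p t
  have hL : ContDiffOn ℝ ∞ L O :=
    contDiffOn_intervalIntegral_param hO hF (by positivity)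
  have hL0 : L (0, v₀) = 0 := by simp [L, F, hfix]
  have hLd : fderiv ℝ L (0, v₀) ∘L .inr ℝ ℂ V = (2 * Real.pi) • ContinuousLinearMap.id ℝ V := by
    have h1 := hasFDerivAt_intervalIntegral_param hO hF 0 (2 * Real.pi) h0
    have h2 : HasFDerivAt (fun v => L (0, v)) (fderiv ℝ L (0, v₀) ∘L .inr ℝ ℂ V) v₀ :=
      (h1.differentiableAt.hasFDerivAt).comp v₀ (hasFDerivAt_prodMk_right 0 v₀)
    have hF2 : ContDiffOn ℝ ∞ (fun q : V × ℝ => F (0, q.1) q.2)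
        (((fun v : V => ((0 : ℂ), v)) ⁻¹' O) ×ˢ univ) :=
      hF.comp (f := fun q : V × ℝ => (((0 : ℂ), q.1), q.2))
        ((contDiff_const.prodMk contDiff_fst).prodMk contDiff_snd).contDiffOn
        fun q hq => ⟨hq.1, mem_univ _⟩
    have h3 := hasFDerivAt_intervalIntegral_param (F := fun v t => F (0, v) t)
      (hO.preimage (by fun_prop)) hF2 0 (2 * Real.pi) (p₀ := v₀) h0
    rw [h2.unique h3]
    have h4 : ∀ t, fderiv ℝ (fun v => F (0, v) t) v₀ = ContinuousLinearMap.id ℝ V := fun t => by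
      have h5 : HasFDerivAt (fun v => F (0, v) t) ((ρ (-t)).comp (ρ t)) v₀ := by
        have h6 : HasFDerivAt (fun v => M t (0, v) - v₀) (ρ t) v₀ := by
          rw [hρ']; exact (hd t).sub_const v₀
        exact (ρ (-t)).hasFDerivAt.comp v₀ h6
      rw [h5.fderiv, ← hρadd, neg_add_cancel, hρzero]
    simp only [h4]
    rw [intervalIntegral.integral_const, sub_zero]
  have hpi : (2 * Real.pi) ≠ 0 := by positivity
  have hinv : (fderiv ℝ L (0, v₀) ∘L .inr ℝ ℂ V).IsInvertible := by
    rw [hLd]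
    exact ⟨ContinuousLinearEquiv.smulLeft (Units.mk0 _ hpi), by ext; rfl⟩
  -- Substituting t + s for t moves ρ(s) out of the integral, and periodicity of the integrand
  -- restores the interval.
  have hLequi : ∀ p ∈ O, ∀ s, ((Circle.exp s : ℂ) * p.1, M s p) ∈ O → L p = 0 →
      L ((Circle.exp s : ℂ) * p.1, M s p) = 0 := by
    intro p hp s hps hLp
    have hper' : Function.Periodic (F p) (2 * Real.pi) := fun t => by
      simp only [F]
      rw [hper p hp, neg_add, ← hρper (-t + -(2 * Real.pi)), neg_add_cancel_right]
    have h1 : ∀ t, F ((Circle.exp s : ℂ) * p.1, M s p) t = ρ s (F p (t + s)) := fun t => by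
      simp only [F]
      rw [hadd p hp t s hps, ← ContinuousLinearMap.comp_apply (ρ s), ← hρadd]
      congr 2
      ring
    have hFt : Continuous (F p) := hF.continuousOn.comp_continuous (f := fun t => (p, t))
      (by fun_prop) fun t => ⟨hp, mem_univ _⟩
    simp only [L, h1]
    have hFs : Continuous fun t => F p (t + s) := by fun_prop
    rw [ContinuousLinearMap.intervalIntegral_comp_comm _ (hFs.intervalIntegrable _ _),
      intervalIntegral.integral_comp_add_right (F p) s, zero_add, add_comm (2 * Real.pi) s,
      hper'.intervalIntegral_add_eq s 0, zero_add]
    exact (congrArg (ρ s) hLp).trans (map_zero _)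
  obtain ⟨ψ, hψ0, hψs, hψ⟩ := exists_contDiff_implicitFunction hO hL h0 hinv
  rw [hL0] at hψ
  dsimp only at hψ0 hψs
  -- shrink the neighbourhood
  have hNc : ContinuousOn (fun q : (ℂ × V) × ℝ => ((Circle.exp q.2 : ℂ) * q.1.1, M q.2 q.1))
      (O ×ˢ univ) := by
    refine ContinuousOn.prodMk (Continuous.continuousOn ?_) hM.continuousOn
    have : Continuous fun t : ℝ => (Circle.exp t : ℂ) :=
      continuous_subtype_val.comp Circle.exp.continuous
    fun_prop
  -- Invariance of the zero set says something about ψ only where zeros of `L` are known to lie on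
  -- its graph. Since the base point is fixed and a period is compact, whole orbits of nearby points
  -- stay in that region.
  have hQ : ∀ᶠ p in 𝓝 ((0 : ℂ), v₀), ∀ t ∈ Icc 0 (2 * Real.pi),
      ((Circle.exp t : ℂ) * p.1, M t p) ∈ O ∧
      (L ((Circle.exp t : ℂ) * p.1, M t p) = 0 ↔ ψ ((Circle.exp t : ℂ) * p.1) = M t p) := by
    refine isCompact_Icc.eventually_forall_of_forall_eventually fun t _ => ?_
    have hcont := hNc.continuousAt (hopen.mem_nhds (⟨h0, mem_univ t⟩ : ((0, v₀), t) ∈ O ×ˢ univ))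
    refine hcont.eventually (p := fun v => v ∈ O ∧ (L v = 0 ↔ ψ v.1 = v.2)) ?_
    simp only [mul_zero, hfix]
    exact Eventually.and (hO.mem_nhds h0) hψ
  have hQ' : ∀ᶠ p in 𝓝 ((0 : ℂ), v₀), ∀ t,
      ((Circle.exp t : ℂ) * p.1, M t p) ∈ O ∧
      (L ((Circle.exp t : ℂ) * p.1, M t p) = 0 ↔ ψ ((Circle.exp t : ℂ) * p.1) = M t p) := by
    filter_upwards [hQ, hO.mem_nhds h0] with p hp hpO t
    have hperM : Function.Periodic (fun t => M t p) (2 * Real.pi) := fun t => hper p hpO t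
    obtain ⟨t', ht', h1, h2⟩ : ∃ t' ∈ Ico 0 (2 * Real.pi), M t p = M t' p ∧
        Circle.exp t = Circle.exp t' := by
      have hboth : Function.Periodic (fun t => (M t p, Circle.exp t)) (2 * Real.pi) := fun t =>
        Prod.ext (hper p hpO t) (Circle.periodic_exp t)
      obtain ⟨t', ht', h⟩ := hboth.exists_mem_Ico₀ (by positivity) t
      exact ⟨t', ht', congrArg Prod.fst h, congrArg Prod.snd h⟩
    rw [h1, h2]
    exact hp t' ⟨ht'.1, ht'.2.le⟩
  have hψt : Tendsto (fun x => (x, ψ x)) (𝓝 0) (𝓝 (0, v₀)) := by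
    have h : ContinuousAt (fun x => (x, ψ x)) 0 :=
      continuousAt_id.prodMk hψs.self_of_nhds.continuousAt
    simpa only [ContinuousAt, hψ0] using h
  have hfin : ∀ᶠ x in 𝓝 (0 : ℂ), ContDiffAt ℝ ∞ ψ x ∧ (x, ψ x) ∈ O ∧ L (x, ψ x) = 0 ∧ ∀ t,
      ((Circle.exp t : ℂ) * x, M t (x, ψ x)) ∈ O ∧
      (L ((Circle.exp t : ℂ) * x, M t (x, ψ x)) = 0 ↔
        ψ ((Circle.exp t : ℂ) * x) = M t (x, ψ x)) := by
    filter_upwards [hψs, hψt.eventually (hO.mem_nhds h0), hψt.eventually hψ,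
      hψt.eventually hQ'] with x h1 h2 h3 h4
    exact ⟨h1, h2, h3.2 rfl, h4⟩
  obtain ⟨δ, hδ, hball⟩ := Metric.eventually_nhds_iff_ball.1 hfin
  refine ⟨δ, hδ, ψ, fun x hx => (hball x hx).1.contDiffWithinAt, hψ0, fun x hx => ?_⟩
  obtain ⟨-, hxO, hx0, hxt⟩ := hball x hx
  exact ⟨hxO, fun t => ((hxt t).2.1 (hLequi _ hxO t (hxt t).1 hx0)).symm⟩

end Analysis

universe u v

/-! ### Smooth lifts of curves to a principal bundle. -/

section Lifts

variable {V : Type v} [NormedAddCommGroup V] [NormedSpace ℝ V]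
  {G : Type u} [Group G] [TopologicalSpace G] [ChartedSpace V G]

/-- In a connected Lie group every element is the end point of a smooth path starting at the
identity which is constant outside the unit interval. -/
theorem exists_smooth_path [LieGroup 𝓘(ℝ, V) ∞ G] [ConnectedSpace G] (g : G) :
    ∃ c : ℝ → G, ContMDiff 𝓘(ℝ, ℝ) 𝓘(ℝ, V) ∞ c ∧ (∀ t ≤ 0, c t = 1) ∧ ∀ t, 1 ≤ t → c t = g := by
  have := topologicalGroup_of_lieGroup 𝓘(ℝ, V) ∞ (G := G)
  -- The reachable end points form a subgroup. Straight segments in a chart, reparametrized to be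
  -- constant near both ends, make it a neighbourhood of 1; so it is open, hence closed, hence
  -- everything.
  let S : Subgroup G :=
    { carrier := {g | ∃ c : ℝ → G, ContMDiff 𝓘(ℝ, ℝ) 𝓘(ℝ, V) ∞ c ∧ (∀ t ≤ 0, c t = 1) ∧
        ∀ t, 1 ≤ t → c t = g}
      one_mem' := ⟨fun _ => 1, contMDiff_const, fun _ _ => rfl, fun _ _ => rfl⟩
      mul_mem' := by
        rintro g h ⟨c, hc, hc0, hc1⟩ ⟨d, hd, hd0, hd1⟩
        exact ⟨fun t => c t * d t, hc.mul hd, fun t ht => by simp [hc0 t ht, hd0 t ht],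
          fun t ht => by simp [hc1 t ht, hd1 t ht]⟩
      inv_mem' := by
        rintro g ⟨c, hc, hc0, hc1⟩
        exact ⟨fun t => (c t)⁻¹, hc.inv, fun t ht => by simp [hc0 t ht],
          fun t ht => by simp [hc1 t ht]⟩ }
  let χ := chartAt V (1 : G)
  have hχ1 : (1 : G) ∈ χ.source := mem_chart_source V 1
  obtain ⟨r, hr, hball⟩ := Metric.isOpen_iff.1 χ.open_target (χ 1) (χ.map_source hχ1)
  have hS : (S : Set G) ∈ 𝓝 (1 : G) := by
    have hc : ContinuousAt χ 1 := χ.continuousAt hχ1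
    filter_upwards [χ.open_source.mem_nhds hχ1, hc (Metric.ball_mem_nhds _ hr)] with h hh hhr
    have hmem : ∀ t, χ 1 + Real.smoothTransition t • (χ h - χ 1) ∈ χ.target := fun t => by
      apply hball
      rw [Metric.mem_ball, dist_eq_norm, add_sub_cancel_left, norm_smul, Real.norm_eq_abs,
        abs_of_nonneg (Real.smoothTransition.nonneg t)]
      have h1 : ‖χ h - χ 1‖ < r := by rw [← dist_eq_norm]; exact hhr
      exact lt_of_le_of_lt (mul_le_of_le_one_left (norm_nonneg _)
        (Real.smoothTransition.le_one t)) h1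
    refine ⟨fun t => χ.symm (χ 1 + Real.smoothTransition t • (χ h - χ 1)), ?_, ?_, ?_⟩
    · have h1 : ContMDiffOn 𝓘(ℝ, V) 𝓘(ℝ, V) ∞ χ.symm χ.target :=
        contMDiffOn_chart_symm
      have h2 : ContDiff ℝ ∞ fun t => χ 1 + Real.smoothTransition t • (χ h - χ 1) :=
        contDiff_const.add (Real.smoothTransition.contDiff.smul contDiff_const)
      exact h1.comp_contMDiff h2.contMDiff hmem
    · intro t ht
      simp [Real.smoothTransition.zero_of_nonpos ht, χ.left_inv hχ1]
    · intro t ht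
      simp [Real.smoothTransition.one_of_one_le ht, χ.left_inv hh]
  have hopen : IsOpen (S : Set G) := S.isOpen_of_mem_nhds hS
  have huniv : (S : Set G) = univ :=
    IsClopen.eq_univ ⟨S.isClosed_of_isOpen hopen, hopen⟩ ⟨1, S.one_mem⟩
  have hg : g ∈ (S : Set G) := by rw [huniv]; exact mem_univ g
  exact hg

namespace PrincipalBundle

variable (η : PrincipalBundle V G)

theorem continuous_proj : Continuous η.proj := η.proj_smooth.continuous

theorem continuous_act : Continuous fun q : η.E × G => η.act q.1 q.2 := η.act_smooth.continuous

section Smooth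

variable {F : Type*} [NormedAddCommGroup F] [NormedSpace ℝ F] {H : Type*} [TopologicalSpace H]
  {I : ModelWithCorners ℝ F H} {M : Type*} [TopologicalSpace M] [ChartedSpace H M]

theorem contMDiffOn_act {s : Set M} {f : M → η.E} {k : M → G}
    (hf : ContMDiffOn I (totalModel V) ∞ f s) (hk : ContMDiffOn I 𝓘(ℝ, V) ∞ k s) :
    ContMDiffOn I (totalModel V) ∞ (fun x => η.act (f x) (k x)) s :=
  η.act_smooth.comp_contMDiffOn (hf.prodMk hk)

/-- The element of `G` carrying one point of a fibre to another one depends smoothly on them. -/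
theorem contMDiffOn_of_act_eq [LieGroup 𝓘(ℝ, V) ∞ G] {s : Set M} {f g : M → η.E} {k : M → G}
    (hf : ContMDiffOn I (totalModel V) ∞ f s) (hg : ContMDiffOn I (totalModel V) ∞ g s)
    (h : ∀ x ∈ s, g x = η.act (f x) (k x)) : ContMDiffOn I 𝓘(ℝ, V) ∞ k s := by
  intro x hx
  obtain ⟨e, hxe, he1, -, he⟩ := η.locally_trivial (η.proj (f x))
  have hfe : f x ∈ e.source := e.mem_source.2 hxe
  have hge : g x ∈ e.source := e.mem_source.2 (by rw [h x hx, η.proj_act]; exact hxe)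
  have h1 : ContMDiffWithinAt I 𝓘(ℝ, V) ∞ (fun y => (e (f y)).2) s x :=
    contMDiffAt_snd.comp_contMDiffWithinAt x
      ((he1.contMDiffAt (e.open_source.mem_nhds hfe)).comp_contMDiffWithinAt x (hf x hx))
  have h2 : ContMDiffWithinAt I 𝓘(ℝ, V) ∞ (fun y => (e (g y)).2) s x :=
    contMDiffAt_snd.comp_contMDiffWithinAt x
      ((he1.contMDiffAt (e.open_source.mem_nhds hge)).comp_contMDiffWithinAt x (hg x hx))
  have heq : ∀ y ∈ s, f y ∈ e.source → k y = (e (f y)).2⁻¹ * (e (g y)).2 := fun y hy hye => by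
    rw [h y hy, he _ hye]; simp
  refine (h1.inv.mul h2).congr_of_eventuallyEq ?_ (heq x hx hfe)
  filter_upwards [(hf x hx).continuousWithinAt.eventually (e.open_source.mem_nhds hfe),
    self_mem_nhdsWithin] with y hy hys using heq y hys hy

end Smooth

theorem continuous_of_act_eq [LieGroup 𝓘(ℝ, V) ∞ G] {M : Type*} [TopologicalSpace M]
    {f g : M → η.E} {k : M → G} (hf : Continuous f) (hg : Continuous g)
    (h : ∀ x, g x = η.act (f x) (k x)) : Continuous k := by
  have := topologicalGroup_of_lieGroup 𝓘(ℝ, V) ∞ (G := G)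
  rw [continuous_iff_continuousAt]
  intro x
  obtain ⟨e, hxe, he1, -, he⟩ := η.locally_trivial (η.proj (f x))
  have hfe : f x ∈ e.source := e.mem_source.2 hxe
  have hge : g x ∈ e.source := e.mem_source.2 (by rw [h x, η.proj_act]; exact hxe)
  have h1 : ContinuousAt (fun y => (e (f y)).2) x :=
    continuousAt_snd.comp ((e.continuousAt hfe).comp hf.continuousAt)
  have h2 : ContinuousAt (fun y => (e (g y)).2) x :=
    continuousAt_snd.comp ((e.continuousAt hge).comp hg.continuousAt)
  have heq : ∀ y, f y ∈ e.source → k y = (e (f y)).2⁻¹ * (e (g y)).2 := fun y hye => by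
    rw [h y, he _ hye]; simp
  refine (h1.inv.mul h2).congr ?_
  filter_upwards [hf.continuousAt.eventually (e.open_source.mem_nhds hfe)] with y hy
  exact (heq y hy).symm

theorem exists_local_section (a : η.E) : ∃ (U : Set S2) (s : S2 → η.E), IsOpen U ∧ η.proj a ∈ U ∧
    ContMDiffOn (𝓡 2) (totalModel V) ∞ s U ∧ (∀ x ∈ U, η.proj (s x) = x) ∧ s (η.proj a) = a := by
  obtain ⟨e, hxe, -, he2, -⟩ := η.locally_trivial (η.proj a)
  refine ⟨e.baseSet, fun x => e.toOpenPartialHomeomorph.symm (x, (e a).2), e.open_baseSet, hxe,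
    ?_, fun x hx => e.proj_symm_apply' hx, ?_⟩
  · exact he2.comp (contMDiff_id.prodMk contMDiff_const).contMDiffOn fun x hx => by
      simpa [e.target_eq] using hx
  · have h : (η.proj a, (e a).2) = e a := by rw [← e.coe_fst (e.mem_source.2 hxe)]
    simp only [h]
    exact e.left_inv (e.mem_source.2 hxe)

/-- Two smooth lifts of a curve on overlapping rays can be joined. -/
theorem exists_join_lifts [LieGroup 𝓘(ℝ, V) ∞ G] [ConnectedSpace G] {m : ℝ → S2} {J : Set ℝ}
    (hJ : IsOpen J)
    {t₀ t₁ : ℝ} (h01 : t₀ < t₁) (htJ : Iio t₁ ⊆ J) {σ₁ σ₂ : ℝ → η.E}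
    (h₁ : ContMDiffOn 𝓘(ℝ, ℝ) (totalModel V) ∞ σ₁ (Iio t₁))
    (p₁ : ∀ t < t₁, η.proj (σ₁ t) = m t)
    (h₂ : ContMDiffOn 𝓘(ℝ, ℝ) (totalModel V) ∞ σ₂ (Ioi t₀ ∩ J))
    (p₂ : ∀ t ∈ Ioi t₀ ∩ J, η.proj (σ₂ t) = m t) :
    ∃ σ : ℝ → η.E, ContMDiffOn 𝓘(ℝ, ℝ) (totalModel V) ∞ σ J ∧ (∀ t ∈ J, η.proj (σ t) = m t) ∧
      (∀ t ≤ t₀, σ t = σ₁ t) ∧ ∀ t, t₁ ≤ t → σ t = σ₂ t := by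
  have hex : ∀ t, ∃ k, t ∈ Ioo t₀ t₁ → σ₂ t = η.act (σ₁ t) k := fun t => by
    by_cases ht : t ∈ Ioo t₀ t₁
    · obtain ⟨k, hk⟩ := η.exists_act_eq
        ((p₂ t ⟨ht.1, htJ ht.2⟩).trans (p₁ t ht.2).symm)
      exact ⟨k, fun _ => hk⟩
    · exact ⟨1, fun h => absurd h ht⟩
  choose k hk using hex
  have hks : ContMDiffOn 𝓘(ℝ, ℝ) 𝓘(ℝ, V) ∞ k (Ioo t₀ t₁) :=
    η.contMDiffOn_of_act_eq (h₁.mono fun t ht => ht.2) (h₂.mono fun t ht => ⟨ht.1, htJ ht.2⟩) hk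
  obtain ⟨a, ha0, ha1⟩ := exists_between h01
  obtain ⟨b, hab, hb1⟩ := exists_between ha1
  obtain ⟨c, hc, hc0, hc1⟩ := exists_smooth_path (V := V) (k a)
  -- Constant `a` up to `a`, the identity from `b` on, and with values in the overlap: `k ∘ φ`
  -- extends `k` from [b, t₁) smoothly to all t < t₁.
  let φ : ℝ → ℝ := fun t => a + Real.smoothTransition ((t - a) / (b - a)) * (t - a)
  have hφs : ContDiff ℝ ∞ φ := by
    refine contDiff_const.add (ContDiff.mul ?_ (contDiff_id.sub contDiff_const))
    exact Real.smoothTransition.contDiff.comp ((contDiff_id.sub contDiff_const).div_const _)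
  have hφa : ∀ t ≤ a, φ t = a := fun t ht => by
    have : Real.smoothTransition ((t - a) / (b - a)) = 0 :=
      Real.smoothTransition.zero_of_nonpos (div_nonpos_of_nonpos_of_nonneg (by linarith)
        (by linarith))
    simp [φ, this]
  have hφb : ∀ t, b ≤ t → φ t = t := fun t ht => by
    have : Real.smoothTransition ((t - a) / (b - a)) = 1 :=
      Real.smoothTransition.one_of_one_le ((one_le_div (by linarith)).2 (by linarith))
    simp [φ, this]
  have hφm : ∀ t < t₁, φ t ∈ Ioo t₀ t₁ := fun t ht => by
    rcases le_total t a with h | h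
    · rw [hφa t h]; exact ⟨ha0, ha1⟩
    · have h1 := Real.smoothTransition.nonneg ((t - a) / (b - a))
      have h2 := Real.smoothTransition.le_one ((t - a) / (b - a))
      have h3 : 0 ≤ t - a := by linarith
      have h4 : Real.smoothTransition ((t - a) / (b - a)) * (t - a) ≤ t - a :=
        mul_le_of_le_one_left h3 h2
      have h5 := mul_nonneg h1 h3
      constructor <;> simp only [φ] <;> linarith
  -- `K` is 1 up to `t₀`, where `c` is 1 and `k a` cancels, and equals `k` from `b` on, where `c`
  -- has arrived at `k a`. Thus σ₁·K starts as σ₁ and has become σ₂ before t₁. The path `c` is where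
  -- connectedness of G enters.
  let K : ℝ → G := fun t => c ((t - t₀) / (a - t₀)) * (k a)⁻¹ * k (φ t)
  have hKs : ContMDiffOn 𝓘(ℝ, ℝ) 𝓘(ℝ, V) ∞ K (Iio t₁) := by
    refine ContMDiffOn.mul (ContMDiff.contMDiffOn (ContMDiff.mul ?_ contMDiff_const)) ?_
    · exact hc.comp ((contDiff_id.sub contDiff_const).div_const _).contMDiff
    · exact hks.comp hφs.contMDiff.contMDiffOn hφm
  have hK0 : ∀ t ≤ t₀, K t = 1 := fun t ht => by
    have h : c ((t - t₀) / (a - t₀)) = 1 :=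
      hc0 _ (div_nonpos_of_nonpos_of_nonneg (by linarith) (by linarith))
    simp [K, h, hφa t (by linarith)]
  have hKb : ∀ t, b ≤ t → K t = k t := fun t ht => by
    have h : c ((t - t₀) / (a - t₀)) = k a :=
      hc1 _ ((one_le_div (by linarith)).2 (by linarith))
    simp [K, h, hφb t ht]
  let σ : ℝ → η.E := fun t => if t < t₁ then η.act (σ₁ t) (K t) else σ₂ t
  have hσ1 : ∀ t < t₁, σ t = η.act (σ₁ t) (K t) := fun t ht => if_pos ht
  have hσ2 : ∀ t, b < t → σ t = σ₂ t := fun t ht => by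
    by_cases h : t < t₁
    · rw [hσ1 t h, hKb t ht.le, hk t ⟨by linarith, h⟩]
    · exact if_neg h
  refine ⟨σ, fun t ht => ?_, fun t ht => ?_, fun t ht => ?_, fun t ht => hσ2 t (by linarith)⟩
  · refine ContMDiffAt.contMDiffWithinAt ?_
    rcases lt_or_ge t t₁ with h | h
    · refine ((η.contMDiffOn_act h₁ hKs).contMDiffAt (Iio_mem_nhds h)).congr_of_eventuallyEq ?_
      filter_upwards [Iio_mem_nhds h] with s hs using hσ1 s hs
    · have hbt : b < t := by linarith
      have hmem : Ioi t₀ ∩ J ∈ 𝓝 t :=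
        inter_mem (Ioi_mem_nhds (by linarith)) (hJ.mem_nhds ht)
      refine (h₂.contMDiffAt hmem).congr_of_eventuallyEq ?_
      filter_upwards [Ioi_mem_nhds hbt] with s hs using hσ2 s hs
  · rcases lt_or_ge t t₁ with h | h
    · rw [hσ1 t h, η.proj_act, p₁ t h]
    · rw [hσ2 t (by linarith), p₂ t ⟨by simp only [mem_Ioi]; linarith, ht⟩]
  · rw [hσ1 t (by linarith), hK0 t ht, η.act_one]

/-- A smooth curve in the base has a smooth lift with prescribed germs at both ends. -/
theorem exists_lift [LieGroup 𝓘(ℝ, V) ∞ G] [ConnectedSpace G] {m : ℝ → S2}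
    (hm : ContMDiff 𝓘(ℝ, ℝ) (𝓡 2) ∞ m)
    {t₀ t₁ : ℝ} {σ₁ σ₂ : ℝ → η.E}
    (h₁ : ContMDiffOn 𝓘(ℝ, ℝ) (totalModel V) ∞ σ₁ (Iio t₁))
    (p₁ : ∀ t < t₁, η.proj (σ₁ t) = m t)
    (h₂ : ContMDiffOn 𝓘(ℝ, ℝ) (totalModel V) ∞ σ₂ (Ioi t₀))
    (p₂ : ∀ t, t₀ < t → η.proj (σ₂ t) = m t) :
    ∃ σ : ℝ → η.E, ContMDiff 𝓘(ℝ, ℝ) (totalModel V) ∞ σ ∧ (∀ t, η.proj (σ t) = m t) ∧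
      (∀ᶠ t in atBot, σ t = σ₁ t) ∧ ∀ᶠ t in atTop, σ t = σ₂ t := by
  -- Continuous induction on the right end of a half-line over which the lift `σ₁`, kept unchanged
  -- up to `t₁ - 1`, extends.
  let S : Set ℝ := {t | ∃ σ : ℝ → η.E, ContMDiffOn 𝓘(ℝ, ℝ) (totalModel V) ∞ σ (Iio t) ∧
    (∀ s < t, η.proj (σ s) = m s) ∧ ∀ s ≤ t₁ - 1, σ s = σ₁ s}
  -- The step size depends only on t: a section near `m t` prolongs every lift that ends within `δ`
  -- of t.
  have hstep : ∀ t, t₁ ≤ t → ∃ δ > 0, ∀ s ∈ S, t - δ < s → s < t + δ → t + δ ∈ S := by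
    intro t ht
    obtain ⟨a, ha⟩ := η.exists_point (m t)
    obtain ⟨U, s, hU, haU, hs, hps, -⟩ := η.exists_local_section a
    rw [ha] at haU
    obtain ⟨δ, hδ, hball⟩ := Metric.isOpen_iff.1 (hU.preimage hm.continuous) t haU
    have hsub : ∀ ε ≤ δ, Ioi (t - ε) ∩ Iio (t + ε) ⊆ m ⁻¹' U := fun ε hε r hr => by
      apply hball
      rw [Real.ball_eq_Ioo]
      exact ⟨by linarith [mem_Ioi.1 hr.1], by linarith [mem_Iio.1 hr.2]⟩
    have hle : min δ 1 ≤ δ := min_le_left _ _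
    have hle' : min δ 1 ≤ 1 := min_le_right _ _
    -- The bound 1 makes the modification take place after `t - 1 ≥ t₁ - 1`, so the germ of `σ₁`
    -- survives.
    refine ⟨min δ 1, lt_min hδ one_pos, ?_⟩
    rintro r ⟨σ, hσ, pσ, eσ⟩ hr1 hr2
    obtain ⟨τ, hτ, pτ, eτ, -⟩ := η.exists_join_lifts isOpen_Iio hr1
      (Iio_subset_Iio hr2.le) hσ pσ (σ₂ := fun r => s (m r))
      (hs.comp hm.contMDiffOn (hsub _ hle)) fun r hr => hps _ (hsub _ hle hr)
    exact ⟨τ, hτ, pτ, fun q hq => (eτ q (by linarith)).trans (eσ q hq)⟩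
  have ht₁ : t₁ ∈ S := ⟨σ₁, h₁, p₁, fun _ _ => rfl⟩
  -- `u` is open, and `hstep` makes it closed relative to [t₁, ∞), so it contains this connected
  -- half-line.
  let u : Set ℝ := {t | ∃ s ∈ S, t < s}
  have hu : IsOpen u := by
    have : u = ⋃ s ∈ S, Iio s := by ext; simp [u]
    rw [this]
    exact isOpen_biUnion fun s _ => isOpen_Iio
  have hsub : Ici t₁ ⊆ u := by
    refine isPreconnected_Ici.subset_of_closure_inter_subset hu ⟨t₁, self_mem_Ici, ?_⟩ ?_
    · obtain ⟨δ, hδ, h⟩ := hstep t₁ le_rfl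
      exact ⟨t₁ + δ, h t₁ ht₁ (by linarith) (by linarith), by linarith⟩
    · rintro t ⟨htc, ht⟩
      obtain ⟨δ, hδ, h⟩ := hstep t ht
      obtain ⟨t', ht', s, hs, hs'⟩ := mem_closure_iff.1 htc (Ioi (t - δ)) isOpen_Ioi
        (by simp only [mem_Ioi]; linarith)
      rcases lt_or_ge s (t + δ) with h' | h'
      · exact ⟨t + δ, h s hs (by linarith [mem_Ioi.1 ht']) h', by linarith⟩
      · exact ⟨s, hs, by linarith⟩
  obtain ⟨T, ⟨σ, hσ, pσ, eσ⟩, hT⟩ := hsub (le_max_left t₁ t₀ : t₁ ≤ max t₁ t₀)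
  have hm1 : t₁ ≤ max t₁ t₀ := le_max_left _ _
  have hm0 : t₀ ≤ max t₁ t₀ := le_max_right _ _
  obtain ⟨τ, hτ, pτ, eτ, eτ'⟩ := η.exists_join_lifts isOpen_univ hT (subset_univ _) hσ pσ
    (h₂.mono fun t ht => lt_of_le_of_lt hm0 ht.1) fun t ht => p₂ t (lt_of_le_of_lt hm0 ht.1)
  refine ⟨τ, contMDiffOn_univ.1 hτ, fun t => pτ t (mem_univ t), ?_, ?_⟩
  · filter_upwards [eventually_le_atBot (t₁ - 1)] with t ht
    exact (eτ t (by linarith)).trans (eσ t ht)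
  · filter_upwards [eventually_ge_atTop T] with t ht using eτ' t ht

end PrincipalBundle

end Lifts

/-! ### Equivariant sections and the existence of framings. -/

section Framings

variable {V : Type v} [NormedAddCommGroup V] [NormedSpace ℝ V]
  {G : Type u} [Group G] [TopologicalSpace G] [ChartedSpace V G]

namespace EquivariantPrincipalBundle

variable (ξ : EquivariantPrincipalBundle V G)

theorem contMDiffOn_rotAct {F : Type*} [NormedAddCommGroup F] [NormedSpace ℝ F] {H : Type*}
    [TopologicalSpace H] {I : ModelWithCorners ℝ F H} {M : Type*} [TopologicalSpace M]
    [ChartedSpace H M] {s : Set M} {f : M → ξ.E} {A : M → SO2}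
    (hA : ContMDiffOn I (𝓡 1) ∞ A s) (hf : ContMDiffOn I (totalModel V) ∞ f s) :
    ContMDiffOn I (totalModel V) ∞ (fun x => ξ.rotAct (A x) (f x)) s :=
  ξ.rotAct_smooth.comp_contMDiffOn (hA.prodMk hf)

/-- The cocycle `c` measures how far `s₀` is from being invariant. Its identity, obtained by acting
with zw in two ways, says that (x, g) ↦ (zx, c(z, x) g) is a circle action on `D` × G. -/
theorem exists_local_cocycle (ε : ℤˣ) {D : Set ℂ} {s₀ : ℂ → ξ.E}
    (hD : ∀ (z : Circle), ∀ x ∈ D, (z : ℂ) * x ∈ D) (hps : ∀ x ∈ D, ξ.proj (s₀ x) = stereo ε x) :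
    ∃ c : Circle → ℂ → G, (∀ z, ∀ x ∈ D,
      ξ.rotAct (rot z) (s₀ x) = ξ.act (s₀ (z * x)) (c z x)) ∧
      ∀ z w, ∀ x ∈ D, c (z * w) x = c z (w * x) * c w x := by
  have hex : ∀ (z : Circle) x, ∃ g, x ∈ D →
      ξ.rotAct (rot z) (s₀ x) = ξ.act (s₀ (z * x)) g := fun z x => by
    by_cases hx : x ∈ D
    · obtain ⟨g, hg⟩ := ξ.exists_act_eq (z := s₀ (z * x)) (w := ξ.rotAct (rot z) (s₀ x))
        (by rw [ξ.proj_rotAct, hps x hx, rotate_stereo, hps _ (hD z x hx)])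
      exact ⟨g, fun _ => hg⟩
    · exact ⟨1, fun h => absurd h hx⟩
  choose c hc using hex
  refine ⟨c, fun z x hx => hc z x hx, fun z w x hx => ?_⟩
  apply ξ.act_left_cancel (z := s₀ ((z * w : Circle) * x))
  rw [← hc _ _ hx, rot_mul, ξ.rotAct_mul, hc w x hx, ξ.rotAct_act, hc z _ (hD w x hx),
    ξ.act_mul, Circle.coe_mul, mul_assoc]

variable [LieGroup 𝓘(ℝ, V) ∞ G]

theorem contMDiffOn_local_cocycle {W : Type*} [NormedAddCommGroup W] [NormedSpace ℝ W]
    {D : Set ℂ} {s₀ : ℂ → ξ.E} (hD : ∀ (z : Circle), ∀ x ∈ D, (z : ℂ) * x ∈ D)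
    (hs₀ : ContMDiffOn 𝓘(ℝ, ℂ) (totalModel V) ∞ s₀ D) {c : Circle → ℂ → G}
    (hc : ∀ z, ∀ x ∈ D, ξ.rotAct (rot z) (s₀ x) = ξ.act (s₀ (z * x)) (c z x))
    {Q : Set W} {z : W → Circle} {x : W → ℂ} (hz : ContMDiffOn 𝓘(ℝ, W) (𝓡 1) ∞ z Q)
    (hx : ContDiffOn ℝ ∞ x Q) (hxD : ∀ q ∈ Q, x q ∈ D) :
    ContMDiffOn 𝓘(ℝ, W) 𝓘(ℝ, V) ∞ (fun q => c (z q) (x q)) Q := by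
  have hz' : ContDiffOn ℝ ∞ (fun q => (z q : ℂ)) Q :=
    (contMDiff_circle_coe.comp_contMDiffOn hz).contDiffOn
  have hf : ContMDiffOn 𝓘(ℝ, W) (totalModel V) ∞ (fun q => s₀ ((z q : ℂ) * x q)) Q :=
    hs₀.comp (hz'.mul hx).contMDiffOn fun q hq => hD _ _ (hxD q hq)
  have hg : ContMDiffOn 𝓘(ℝ, W) (totalModel V) ∞ (fun q => ξ.rotAct (rot (z q)) (s₀ (x q))) Q :=
    ξ.contMDiffOn_rotAct (contMDiff_rot.comp_contMDiffOn hz) (hs₀.comp hx.contMDiffOn hxD)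
  exact ξ.contMDiffOn_of_act_eq hf hg fun q hq => hc _ _ (hxD q hq)

/-- Near a pole there is a smooth section which is equivariant up to the isotropy
representation. -/
theorem exists_local_equivariant_section [FiniteDimensional ℝ V] (ε : ℤˣ) (a : ξ.E)
    (ha : ξ.proj a = pole ε) (γ : SmoothHom V G) (hγ : ∀ A, ξ.rotAct A a = ξ.act a (γ A)) :
    ∃ δ > 0, ∃ s : ℂ → ξ.E,
      ContMDiffOn 𝓘(ℝ, ℂ) (totalModel V) ∞ s (Metric.ball 0 δ) ∧
      (∀ x ∈ Metric.ball 0 δ, ξ.proj (s x) = stereo ε x) ∧ s 0 = a ∧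
      ∀ (z : Circle), ∀ x ∈ Metric.ball 0 δ,
        ξ.rotAct (rot z) (s x) = ξ.act (s (z * x)) (γ (rot z)) := by
  have htg := topologicalGroup_of_lieGroup 𝓘(ℝ, V) ∞ (G := G)
  obtain ⟨U, s', hU, haU, hs', hps', hsa⟩ := ξ.exists_local_section a
  rw [ha] at haU hsa
  obtain ⟨r, hr, hball⟩ := Metric.isOpen_iff.1
    (hU.preimage (contMDiff_stereo ε).continuous) 0 (by simpa [stereo_zero] using haU)
  set D : Set ℂ := Metric.ball 0 r with hDdef
  let s₀ : ℂ → ξ.E := fun x => s' (stereo ε x)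
  have hs₀ : ContMDiffOn 𝓘(ℝ, ℂ) (totalModel V) ∞ s₀ D :=
    hs'.comp (contMDiff_stereo ε).contMDiffOn hball
  have hps₀ : ∀ x ∈ D, ξ.proj (s₀ x) = stereo ε x := fun x hx => hps' _ (hball hx)
  have hs₀a : s₀ 0 = a := by simp [s₀, stereo_zero, hsa]
  have hD : ∀ (z : Circle), ∀ x ∈ D, (z : ℂ) * x ∈ D := fun z x hx => by
    simpa only [hDdef, mem_ball_zero_iff, norm_mul, Circle.norm_coe, one_mul] using hx
  have h0D : (0 : ℂ) ∈ D := Metric.mem_ball_self hr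
  obtain ⟨c, hc, hcmul⟩ := ξ.exists_local_cocycle ε hD hps₀
  have hc0 : ∀ z, c z 0 = γ (rot z) := fun z => by
    apply ξ.act_left_cancel (z := a)
    rw [← hγ, ← hs₀a, hc z 0 h0D, mul_zero]
  let χ := chartAt V (1 : G)
  have hχ1 : (1 : G) ∈ χ.source := mem_chart_source V 1
  -- The section s₀·g is equivariant up to γ exactly when g(zx) = c(z, x) g(x) γ(z)⁻¹, that is, when
  -- the graph of g is invariant under a circle action on `D` × G. `N` is the G-component of this
  -- action, with g read in the chart at 1. As c(z, 0) = γ(z), the point (0, 1) is fixed.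
  let N : (ℂ × V) × ℝ → G := fun q =>
    c (Circle.exp q.2) q.1.1 * χ.symm q.1.2 * (γ (rot (Circle.exp q.2)))⁻¹
  let Q : Set ((ℂ × V) × ℝ) := (D ×ˢ χ.target) ×ˢ univ
  have hQ : IsOpen Q := (Metric.isOpen_ball.prod χ.open_target).prod isOpen_univ
  have hexp : ContMDiff 𝓘(ℝ, (ℂ × V) × ℝ) (𝓡 1) ∞ fun q : (ℂ × V) × ℝ => Circle.exp q.2 :=
    contMDiff_circleExp.comp contDiff_snd.contMDiff
  have hrot := contMDiff_rot.comp hexp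
  have hx : ContDiff ℝ ∞ fun q : (ℂ × V) × ℝ => q.1.1 := contDiff_fst.fst
  have hv : ContDiff ℝ ∞ fun q : (ℂ × V) × ℝ => q.1.2 := contDiff_fst.snd
  have hcs : ContMDiffOn 𝓘(ℝ, (ℂ × V) × ℝ) 𝓘(ℝ, V) ∞
      (fun q : (ℂ × V) × ℝ => c (Circle.exp q.2) q.1.1) Q :=
    ξ.contMDiffOn_local_cocycle hD hs₀ hc hexp.contMDiffOn hx.contDiffOn fun q hq => hq.1.1
  have hN : ContMDiffOn 𝓘(ℝ, (ℂ × V) × ℝ) 𝓘(ℝ, V) ∞ N Q := by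
    refine (hcs.mul ?_).mul (γ.contMDiff_toFun.comp hrot).inv.contMDiffOn
    exact contMDiffOn_chart_symm.comp hv.contMDiff.contMDiffOn fun q hq => hq.1.2
  have hN0 : ∀ t, N ((0, χ 1), t) = 1 := fun t => by
    simp [N, hc0, χ.left_inv hχ1]
  have hmem0 : ∀ t, ((0, χ 1), t) ∈ Q := fun t =>
    ⟨⟨h0D, χ.map_source hχ1⟩, mem_univ _⟩
  -- By compactness of a period, orbits of points near the fixed point remain in the domain of the
  -- chart, so the action can be written in V for all times.
  have hnear : ∀ᶠ p in 𝓝 ((0 : ℂ), χ 1), ∀ t ∈ Icc 0 (2 * Real.pi),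
      (p, t) ∈ Q ∧ N (p, t) ∈ χ.source := by
    refine isCompact_Icc.eventually_forall_of_forall_eventually fun t _ => ?_
    refine Eventually.and (hQ.mem_nhds (hmem0 t)) ?_
    refine (hN.continuousOn.continuousAt (hQ.mem_nhds (hmem0 t))).eventually
      (χ.open_source.mem_nhds ?_)
    rw [hN0]
    exact hχ1
  obtain ⟨O, hOsub, hO, h0O⟩ := eventually_nhds_iff.1 hnear
  have hOt : ∀ p ∈ O, ∀ t, (p, t) ∈ Q ∧ N (p, t) ∈ χ.source := fun p hp t => by
    obtain ⟨t', ht', h⟩ := Circle.periodic_exp.exists_mem_Ico₀ (by positivity) t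
    have h' : N (p, t) = N (p, t') := by simp only [N, h]
    rw [h']
    exact ⟨⟨(hOsub p hp t' ⟨ht'.1, ht'.2.le⟩).1.1, mem_univ _⟩,
      (hOsub p hp t' ⟨ht'.1, ht'.2.le⟩).2⟩
  have hsm : ContMDiffOn 𝓘(ℝ, (ℂ × V) × ℝ) 𝓘(ℝ, V) ∞ (fun q => χ (N q)) (O ×ˢ univ) :=
    contMDiffOn_chart.comp (hN.mono fun q hq => (hOt _ hq.1 q.2).1)
      fun q hq => (hOt _ hq.1 q.2).2
  have hone : ∀ p ∈ O, χ (N (p, 0)) = p.2 := fun p hp => by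
    have h1 : c 1 p.1 = 1 := by
      have h := hcmul 1 1 p.1 (hOt p hp 0).1.1.1
      simpa using h
    simp [N, h1, rot_one, χ.right_inv (hOt p hp 0).1.1.2]
  have hadd : ∀ p ∈ O, ∀ s t, ((Circle.exp t : ℂ) * p.1, χ (N (p, t))) ∈ O →
      χ (N (((Circle.exp t : ℂ) * p.1, χ (N (p, t))), s)) = χ (N (p, s + t)) := by
    intro p hp s t _
    have h2 := χ.left_inv (hOt p hp t).2
    have h1 : N (((Circle.exp t : ℂ) * p.1, χ (N (p, t))), s) = N (p, s + t) := by
      simp only [N] at h2 ⊢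
      rw [h2, Circle.exp_add, hcmul _ _ _ (hOt p hp 0).1.1.1, rot_mul, map_mul]
      group
    rw [h1]
  obtain ⟨δ, hδ, w, hw, hw0, hwO⟩ := exists_invariant_graph
    (M := fun t p => χ (N (p, t))) hO h0O hsm.contDiffOn
    (fun p _ t => by simp only [N, Circle.periodic_exp t]) (fun t => by simp only [hN0])
    hone hadd
  refine ⟨δ, hδ, fun x => ξ.act (s₀ x) (χ.symm (w x)), ?_, fun x hx => ?_, ?_, fun z x hx => ?_⟩
  · refine ξ.contMDiffOn_act (hs₀.mono fun x hx => (hOt _ (hwO x hx).1 0).1.1.1) ?_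
    exact contMDiffOn_chart_symm.comp hw.contMDiffOn fun x hx => (hOt _ (hwO x hx).1 0).1.1.2
  · rw [ξ.proj_act, hps₀ x (hOt _ (hwO x hx).1 0).1.1.1]
  · simp only [hw0, hs₀a, χ.left_inv hχ1, ξ.act_one]
  · obtain ⟨t, rfl⟩ := Circle.exp_surjective z
    obtain ⟨hxO, hxt⟩ := hwO x hx
    rw [ξ.rotAct_act, hc _ _ (hOt _ hxO 0).1.1.1, ← ξ.act_mul, ← ξ.act_mul, ← hxt t,
      χ.left_inv (hOt _ hxO t).2]
    simp [N]

/-- Equivariance forces S(zr) = z·τ(log r)·γ(z)⁻¹ for r > 0. This is smooth away from 0; near 0 it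
coincides with `s`, because `τ` does so at small radii and `s` obeys the same law. -/
theorem exists_equivariant_section_of_lift (ε : ℤˣ) (γ : SmoothHom V G) {δ : ℝ} (hδ : 0 < δ)
    {s : ℂ → ξ.E} (hs : ContMDiffOn 𝓘(ℝ, ℂ) (totalModel V) ∞ s (Metric.ball 0 δ))
    (hps : ∀ x ∈ Metric.ball 0 δ, ξ.proj (s x) = stereo ε x)
    (hse : ∀ (z : Circle), ∀ x ∈ Metric.ball 0 δ,
        ξ.rotAct (rot z) (s x) = ξ.act (s (z * x)) (γ (rot z)))
    {τ : ℝ → ξ.E} (hτ : ContMDiff 𝓘(ℝ, ℝ) (totalModel V) ∞ τ)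
    (hpτ : ∀ t : ℝ, ξ.proj (τ t) = stereo ε (Real.exp t))
    (hsτ : ∀ᶠ t in atBot, τ t = s (Real.exp t)) :
    ∃ S : ℂ → ξ.E, ContMDiff 𝓘(ℝ, ℂ) (totalModel V) ∞ S ∧ (∀ x, ξ.proj (S x) = stereo ε x) ∧
      (∀ (z : Circle) x, ξ.rotAct (rot z) (S x) = ξ.act (S (z * x)) (γ (rot z))) ∧
      (∀ t : ℝ, S (Real.exp t) = τ t) ∧ S 0 = s 0 := by
  have h0 : (0 : ℂ) ∈ Metric.ball 0 δ := Metric.mem_ball_self hδ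
  let T : ℂ → ξ.E := fun x =>
    ξ.act (ξ.rotAct (rot (ang x)) (τ (Real.log ‖x‖))) (γ (rot (ang x)))⁻¹
  have hrot : ContMDiffOn 𝓘(ℝ, ℂ) (𝓡 1) ∞ (fun x => rot (ang x)) {0}ᶜ :=
    contMDiff_rot.comp_contMDiffOn contMDiffOn_ang
  have hT : ContMDiffOn 𝓘(ℝ, ℂ) (totalModel V) ∞ T {0}ᶜ := by
    refine ξ.contMDiffOn_act (ξ.contMDiffOn_rotAct hrot ?_)
      (γ.contMDiff_toFun.comp_contMDiffOn hrot).inv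
    refine hτ.comp_contMDiffOn (ContDiffOn.contMDiffOn ?_)
    exact (contDiffOn_id.norm ℝ fun x hx => hx).log fun x hx => norm_ne_zero_iff.2 hx
  let S : ℂ → ξ.E := fun x => if x = 0 then s 0 else T x
  have hS0 : S 0 = s 0 := if_pos rfl
  have hST : ∀ x, x ≠ 0 → S x = T x := fun x hx => if_neg hx
  have hnorm : ∀ x : ℂ, x ≠ 0 → ((Real.exp (Real.log ‖x‖) : ℝ) : ℂ) = ‖x‖ := fun x hx => by
    rw [Real.exp_log (norm_pos_iff.2 hx)]
  obtain ⟨t₀, ht₀⟩ := eventually_atBot.1 hsτ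
  have hSs : ∀ x ∈ Metric.ball (0 : ℂ) (min δ (Real.exp t₀)), S x = s x := fun x hx => by
    by_cases hx0 : x = 0
    · rw [hx0, hS0]
    · have hxn : ‖x‖ < min δ (Real.exp t₀) := by simpa using hx
      have hpos := norm_pos_iff.2 hx0
      have hlog : Real.log ‖x‖ ≤ t₀ :=
        (Real.log_le_iff_le_exp hpos).2 (hxn.trans_le (min_le_right _ _)).le
      have hmem : ((‖x‖ : ℝ) : ℂ) ∈ Metric.ball (0 : ℂ) δ := by
        simpa using hxn.trans_le (min_le_left _ _)
      rw [hST x hx0]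
      simp only [T]
      rw [ht₀ _ hlog, hnorm x hx0, hse _ _ hmem, ang_mul_norm hx0, ← ξ.act_mul, mul_inv_cancel,
        ξ.act_one]
  refine ⟨S, fun x => ?_, fun x => ?_, fun z x => ?_, fun t => ?_, hS0⟩
  · by_cases hx0 : x = 0
    · rw [hx0]
      refine (hs.contMDiffAt (Metric.ball_mem_nhds 0 hδ)).congr_of_eventuallyEq ?_
      filter_upwards [Metric.ball_mem_nhds (0 : ℂ) (lt_min hδ (Real.exp_pos t₀))] with y hy
        using hSs y hy
    · have hmem : ({0}ᶜ : Set ℂ) ∈ 𝓝 x := isOpen_compl_singleton.mem_nhds hx0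
      refine (hT.contMDiffAt hmem).congr_of_eventuallyEq ?_
      filter_upwards [hmem] with y hy using hST y hy
  · by_cases hx0 : x = 0
    · rw [hx0, hS0, hps 0 h0]
    · rw [hST x hx0]
      simp only [T]
      rw [ξ.proj_act, ξ.proj_rotAct, hpτ, rotate_stereo, hnorm x hx0, ang_mul_norm hx0]
  · by_cases hx0 : x = 0
    · rw [hx0, mul_zero, hS0, hse z 0 h0, mul_zero]
    · have hzx : (z : ℂ) * x ≠ 0 := mul_ne_zero (Circle.coe_ne_zero z) hx0
      rw [hST x hx0, hST _ hzx]
      simp only [T]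
      rw [ang_circle_mul z hx0, norm_mul, Circle.norm_coe, one_mul, rot_mul, ξ.rotAct_mul,
        map_mul, ← ξ.act_mul, ξ.rotAct_act, mul_inv_rev, inv_mul_cancel_right]
  · have hne : ((Real.exp t : ℝ) : ℂ) ≠ 0 := by
      simpa only [ne_eq, Complex.ofReal_eq_zero] using (Real.exp_pos t).ne'
    rw [hST _ hne]
    simp only [T]
    rw [ang_ofReal (Real.exp_pos t), rot_one, map_one, inv_one, ξ.act_one, ξ.rotAct_one,
      Complex.norm_real, Real.norm_eq_abs, Real.abs_exp, Real.log_exp]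

/-- Smooth sections over the complements of the poles, equivariant up to the representations `γ`,
which agree on a meridian. -/
structure Framing (γ : ℤˣ → SmoothHom V G) where
  s : ℤˣ → ℂ → ξ.E
  smooth : ∀ ε, ContMDiff 𝓘(ℝ, ℂ) (totalModel V) ∞ (s ε)
  proj_s : ∀ ε x, ξ.proj (s ε x) = stereo ε x
  rotAct_s : ∀ ε (z : Circle) x, ξ.rotAct (rot z) (s ε x) = ξ.act (s ε (z * x)) (γ ε (rot z))
  agree : ∀ t : ℝ, s (-1) (Real.exp t) = s 1 (Real.exp (-t))

/-- The meridian t ↦ `stereo (-1) (exp t)` runs from the south pole to the north pole. The local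
equivariant sections prescribe the germs of a lift at both ends, and one lift with these germs, read
backwards for the north chart, generates both sections; hence they agree along it. -/
theorem exists_framing [FiniteDimensional ℝ V] [ConnectedSpace G] (γ : ℤˣ → SmoothHom V G)
    (a : ℤˣ → ξ.E) (ha : ∀ ε, ξ.proj (a ε) = pole ε)
    (hγ : ∀ ε A, ξ.rotAct A (a ε) = ξ.act (a ε) (γ ε A)) :
    ∃ f : ξ.Framing γ, ∀ ε, f.s ε 0 = a ε := by
  choose δ hδ s hs hps hs0 hse using fun ε =>
    ξ.exists_local_equivariant_section ε (a ε) (ha ε) (γ ε) (hγ ε)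
  have hexp : ContMDiff 𝓘(ℝ, ℝ) 𝓘(ℝ, ℂ) ∞ fun t : ℝ => ((Real.exp t : ℝ) : ℂ) :=
    (Complex.ofRealCLM.contDiff.comp Real.contDiff_exp).contMDiff
  have hneg : ContMDiff 𝓘(ℝ, ℝ) 𝓘(ℝ, ℝ) ∞ fun t : ℝ => -t := contDiff_neg.contMDiff
  have hball : ∀ ε, ∀ t < Real.log (δ ε), ((Real.exp t : ℝ) : ℂ) ∈ Metric.ball 0 (δ ε) :=
    fun ε t ht => by
      rw [mem_ball_zero_iff, Complex.norm_real, Real.norm_eq_abs, Real.abs_exp]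
      exact (Real.lt_log_iff_exp_lt (hδ ε)).1 ht
  have hmer : ∀ t : ℝ, stereo 1 (Real.exp (-t)) = stereo (-1) (Real.exp t) := fun t => by
    simpa using (stereo_neg_exp 1 1 t).symm
  obtain ⟨σ, hσ, pσ, σbot, σtop⟩ := ξ.exists_lift
    -- Seen from the north pole the radius is `exp (-t)`, which is less than `δ 1` exactly for `t >
    -- -log (δ 1)`.
    (m := fun t : ℝ => stereo (-1) (Real.exp t)) (t₀ := -Real.log (δ 1)) (t₁ := Real.log (δ (-1)))
    (σ₁ := fun t => s (-1) (Real.exp t)) (σ₂ := fun t => s 1 (Real.exp (-t)))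
    ((contMDiff_stereo _).comp hexp)
    ((hs (-1)).comp hexp.contMDiffOn (hball (-1))) (fun t ht => hps _ _ (hball _ t ht))
    ((hs 1).comp (hexp.comp hneg).contMDiffOn fun t ht => hball 1 (-t) (by
      linarith [mem_Ioi.1 ht]))
    (fun t ht => (hps _ _ (hball _ (-t) (by linarith))).trans (hmer t))
  obtain ⟨S, hS, pS, eS, mS, zS⟩ := ξ.exists_equivariant_section_of_lift (-1) (γ (-1)) (hδ (-1))
    (hs (-1)) (hps (-1)) (hse (-1)) hσ pσ σbot
  obtain ⟨S', hS', pS', eS', mS', zS'⟩ := ξ.exists_equivariant_section_of_lift 1 (γ 1) (hδ 1)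
    (hs 1) (hps 1) (hse 1) (τ := fun t => σ (-t)) (hσ.comp hneg)
    (fun t => by rw [pσ, ← hmer, neg_neg])
    ((tendsto_neg_atBot_atTop.eventually σtop).mono fun t ht => by rw [ht, neg_neg])
  refine ⟨⟨fun ε => if ε = 1 then S' else S, fun ε => ?_, fun ε => ?_, fun ε => ?_, fun t => ?_⟩,
    fun ε => ?_⟩
  · rcases Int.units_eq_one_or ε with rfl | rfl <;> simpa
  · rcases Int.units_eq_one_or ε with rfl | rfl <;> simpa
  · rcases Int.units_eq_one_or ε with rfl | rfl <;> simpa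
  · have h := mS' (-t)
    rw [neg_neg, ← mS t] at h
    simpa using h.symm
  · rcases Int.units_eq_one_or ε with rfl | rfl
    · simpa using zS'.trans (hs0 1)
    · simpa using zS.trans (hs0 (-1))

end EquivariantPrincipalBundle

end Framings

/-! ### Injectivity of `J`. -/

section Injectivity

variable {V : Type v} [NormedAddCommGroup V] [NormedSpace ℝ V]
  {G : Type u} [Group G] [TopologicalSpace G] [ChartedSpace V G]

/-- Every point of the sphere has a stereographic coordinate. -/
theorem exists_ne_pole (x : S2) : ∃ ε, x ≠ pole (-ε) := by
  by_cases h : x = pole (-1)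
  · refine ⟨-1, ?_⟩
    rw [h]
    exact pole_ne_neg (-1)
  · exact ⟨1, h⟩

theorem stereo_injective (ε : ℤˣ) : Function.Injective (stereo ε) := fun x y h => by
  rw [← coord_stereo ε x, h, coord_stereo]

/-- Polar form of the chart change: a point of the overlap is not a pole, so it has an angle. -/
theorem stereo_eq_stereo_neg {ε : ℤˣ} {x y : ℂ} (h : stereo (-ε) x = stereo ε y) :
    ∃ (z : Circle) (t : ℝ), x = z * Real.exp t ∧ y = z * Real.exp (-t) := by
  have hx : x ≠ 0 := by
    rintro rfl
    rw [stereo_zero] at h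
    exact stereo_ne ε y h.symm
  have hx' : x = ang x * Real.exp (Real.log ‖x‖) := by
    rw [Real.exp_log (norm_pos_iff.2 hx), ang_mul_norm hx]
  refine ⟨ang x, Real.log ‖x‖, hx', stereo_injective ε ?_⟩
  rw [← stereo_neg_exp, ← hx', h]

namespace EquivariantPrincipalBundle

namespace Framing

variable {ξ ξ' : EquivariantPrincipalBundle V G} {γ : ℤˣ → SmoothHom V G}

/-- Obtained by rotating the agreement on the meridian by z. The transition function involves only
γ, nothing else of the bundle. -/
theorem s_neg (f : ξ.Framing γ) (ε : ℤˣ) (z : Circle) (t : ℝ) :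
    f.s (-ε) (z * Real.exp t) =
      ξ.act (f.s ε (z * Real.exp (-t))) (γ ε (rot z) * (γ (-ε) (rot z))⁻¹) := by
  have h1 : f.s (-ε) (Real.exp t) = f.s ε (Real.exp (-t)) := by
    rcases Int.units_eq_one_or ε with rfl | rfl
    · exact f.agree t
    · have h := f.agree (-t)
      rw [neg_neg] at h
      rw [neg_neg, h]
  have h2 := congrArg (ξ.rotAct (rot z)) h1
  rw [f.rotAct_s, f.rotAct_s] at h2
  rw [ξ.act_mul, ← h2, ← ξ.act_mul, mul_inv_cancel, ξ.act_one]

theorem exists_eq_act (f : ξ.Framing γ) {ε : ℤˣ} {p : ξ.E} (hp : ξ.proj p ≠ pole (-ε)) :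
    ∃ g, p = ξ.act (f.s ε (coord ε (ξ.proj p))) g :=
  ξ.exists_act_eq (by rw [f.proj_s, stereo_coord hp])

/-- Keeping the coordinates (x, g) of a point while changing the framing is independent of the
chart, since both framings have the same transition function. -/
theorem exists_corresponding (f : ξ.Framing γ) (f' : ξ'.Framing γ) (p : ξ.E) :
    ∃ p' : ξ'.E, ∀ ε x g, p = ξ.act (f.s ε x) g → p' = ξ'.act (f'.s ε x) g := by
  obtain ⟨ε₀, hε₀⟩ := exists_ne_pole (ξ.proj p)
  obtain ⟨g₀, hg₀⟩ := f.exists_eq_act hε₀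
  set y := coord ε₀ (ξ.proj p)
  refine ⟨ξ'.act (f'.s ε₀ y) g₀, fun ε x g h => ?_⟩
  have hst : stereo ε x = stereo ε₀ y := by
    rw [← f.proj_s, ← f.proj_s, ← ξ.proj_act (f.s ε x) g, ← h, hg₀, ξ.proj_act]
  by_cases hε : ε = ε₀
  · subst hε
    have hxy : x = y := stereo_injective ε hst
    subst hxy
    rw [ξ.act_left_cancel (hg₀.symm.trans h)]
  · obtain rfl : ε = -ε₀ := by
      rcases Int.units_eq_one_or ε with rfl | rfl <;>
        rcases Int.units_eq_one_or ε₀ with h0 | h0 <;> simp_all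
    obtain ⟨z, t, hx, hy⟩ := stereo_eq_stereo_neg hst
    rw [hx, f.s_neg, ← hy, ← ξ.act_mul] at h
    rw [hx, f'.s_neg, ← hy, ← ξ'.act_mul, ξ.act_left_cancel (hg₀.symm.trans h)]

/-- The map of total spaces defined by two framings. -/
def map (f : ξ.Framing γ) (f' : ξ'.Framing γ) (p : ξ.E) : ξ'.E :=
  (f.exists_corresponding f' p).choose

theorem map_act (f : ξ.Framing γ) (f' : ξ'.Framing γ) (ε : ℤˣ) (x : ℂ) (g : G) :
    f.map f' (ξ.act (f.s ε x) g) = ξ'.act (f'.s ε x) g :=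
  (f.exists_corresponding f' _).choose_spec ε x g rfl

theorem exists_eq (f : ξ.Framing γ) (p : ξ.E) : ∃ ε x g, p = ξ.act (f.s ε x) g := by
  obtain ⟨ε, hε⟩ := exists_ne_pole (ξ.proj p)
  obtain ⟨g, hg⟩ := f.exists_eq_act hε
  exact ⟨ε, _, g, hg⟩

theorem map_map (f : ξ.Framing γ) (f' : ξ'.Framing γ) (p : ξ.E) : f'.map f (f.map f' p) = p := by
  obtain ⟨ε, x, g, rfl⟩ := f.exists_eq p
  rw [map_act, map_act]

theorem contMDiff_map [LieGroup 𝓘(ℝ, V) ∞ G] (f : ξ.Framing γ)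
    (f' : ξ'.Framing γ) :
    ContMDiff (totalModel V) (totalModel V) ∞ (f.map f') := by
  intro p
  obtain ⟨ε, hε⟩ := exists_ne_pole (ξ.proj p)
  let U : Set ξ.E := ξ.proj ⁻¹' {pole (-ε)}ᶜ
  have hU : IsOpen U := isOpen_compl_singleton.preimage ξ.continuous_proj
  have hx : ContMDiffOn (totalModel V) 𝓘(ℝ, ℂ) ∞ (fun q => coord ε (ξ.proj q)) U :=
    (contMDiffOn_coord ε).comp ξ.proj_smooth.contMDiffOn fun q hq => hq
  have hex : ∀ q, ∃ g, q ∈ U → q = ξ.act (f.s ε (coord ε (ξ.proj q))) g := fun q => by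
    by_cases hq : q ∈ U
    · obtain ⟨g, hg⟩ := f.exists_eq_act (ε := ε) (p := q) hq
      exact ⟨g, fun _ => hg⟩
    · exact ⟨1, fun h => absurd h hq⟩
  choose k hk using hex
  have hks : ContMDiffOn (totalModel V) 𝓘(ℝ, V) ∞ k U :=
    ξ.contMDiffOn_of_act_eq ((f.smooth ε).comp_contMDiffOn hx) contMDiffOn_id hk
  have hsm := ξ'.contMDiffOn_act ((f'.smooth ε).comp_contMDiffOn hx) hks
  refine (hsm.congr fun q hq => ?_).contMDiffAt (hU.mem_nhds hε)
  conv_lhs => rw [hk q hq]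
  exact f.map_act f' ε _ _

theorem isomorphic [LieGroup 𝓘(ℝ, V) ∞ G] (f : ξ.Framing γ) (f' : ξ'.Framing γ) :
    Isomorphic ξ ξ' := by
  refine ⟨⟨⟨f.map f', f'.map f, f.map_map f', f'.map_map f⟩, f.contMDiff_map f',
    f'.contMDiff_map f⟩, fun p g => ?_, fun A p => ?_, fun p => ?_⟩
  · obtain ⟨ε, x, h, rfl⟩ := f.exists_eq p
    change f.map f' _ = ξ'.act (f.map f' _) g
    rw [← ξ.act_mul, map_act, map_act, ξ'.act_mul]
  · obtain ⟨ε, x, h, rfl⟩ := f.exists_eq p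
    obtain ⟨z, rfl⟩ := rot_surjective A
    change f.map f' _ = ξ'.rotAct (rot z) (f.map f' _)
    rw [map_act, ξ.rotAct_act, f.rotAct_s, ← ξ.act_mul, map_act, ξ'.rotAct_act, f'.rotAct_s,
      ξ'.act_mul]
  · obtain ⟨ε, x, h, rfl⟩ := f.exists_eq p
    change ξ'.proj (f.map f' _) = _
    rw [map_act, ξ'.proj_act, ξ.proj_act, f.proj_s, f'.proj_s]

end Framing

/-- Moving the point along its fibre conjugates its isotropy representation, so every representative
of the class is realized exactly. -/
theorem exists_point_of_isotropyClass [LieGroup 𝓘(ℝ, V) ∞ G]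
    (ξ : EquivariantPrincipalBundle V G) {x : S2}
    (hx : ∀ A, rotate A x = x) {α : SmoothHom V G}
    (h : ξ.isotropyClass x hx = Quotient.mk (conjSetoid V G) α) :
    ∃ a, ξ.proj a = x ∧ ∀ A, ξ.rotAct A a = ξ.act a (α A) := by
  obtain ⟨a, ha⟩ := ξ.exists_point x
  have hax : ∀ A, rotate A (ξ.proj a) = ξ.proj a := by rw [ha]; exact hx
  rw [ξ.isotropyClass_eq x hx a ha _ (ξ.isotropyRep_spec a hax)] at h
  obtain ⟨g, hg⟩ := Quotient.exact h
  refine ⟨ξ.act a g⁻¹, by rw [ξ.proj_act, ha], fun A => ?_⟩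
  rw [ξ.rotAct_act, ξ.isotropyRep_spec a hax, ← ξ.act_mul, ← ξ.act_mul, hg A]
  congr 1
  group

/-- A pair of representations, indexed by the poles. -/
def repPair (α β : SmoothHom V G) (ε : ℤˣ) : SmoothHom V G := if ε = 1 then β else α

theorem repPair_one (α β : SmoothHom V G) : repPair α β 1 = β := by simp [repPair]

theorem repPair_neg_one (α β : SmoothHom V G) : repPair α β (-1) = α := by simp [repPair]

theorem exists_framing_of_J [LieGroup 𝓘(ℝ, V) ∞ G] [FiniteDimensional ℝ V] [ConnectedSpace G]
    (ξ : EquivariantPrincipalBundle V G) {α β : SmoothHom V G}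
    (h : J (Quotient.mk (isoSetoid V G) ξ) =
      (Quotient.mk (conjSetoid V G) α, Quotient.mk (conjSetoid V G) β)) :
    Nonempty (ξ.Framing (repPair α β)) := by
  obtain ⟨a, ha, hα⟩ := ξ.exists_point_of_isotropyClass rotate_southPole (congrArg Prod.fst h)
  obtain ⟨b, hb, hβ⟩ := ξ.exists_point_of_isotropyClass rotate_northPole (congrArg Prod.snd h)
  obtain ⟨f, -⟩ := ξ.exists_framing (repPair α β) (fun ε => if ε = 1 then b else a)
    (fun ε => by
      rcases Int.units_eq_one_or ε with rfl | rfl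
      · simpa [pole_one] using hb
      · simpa [pole_neg_one] using ha)
    (fun ε A => by
      rcases Int.units_eq_one_or ε with rfl | rfl
      · simpa [repPair] using hβ A
      · simpa [repPair] using hα A)
  exact ⟨f⟩

end EquivariantPrincipalBundle

theorem J_injective [LieGroup 𝓘(ℝ, V) ∞ G] [FiniteDimensional ℝ V] [ConnectedSpace G] :
    Function.Injective (J (V := V) (G := G)) := by
  intro c c' h
  induction c using Quotient.inductionOn with | _ ξ
  induction c' using Quotient.inductionOn with | _ ξ'
  obtain ⟨α, hα⟩ := Quotient.exists_rep (J (Quotient.mk (isoSetoid V G) ξ)).1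
  obtain ⟨β, hβ⟩ := Quotient.exists_rep (J (Quotient.mk (isoSetoid V G) ξ)).2
  have h1 : J (Quotient.mk (isoSetoid V G) ξ) =
      (Quotient.mk (conjSetoid V G) α, Quotient.mk (conjSetoid V G) β) :=
    Prod.ext hα.symm hβ.symm
  obtain ⟨f⟩ := ξ.exists_framing_of_J h1
  obtain ⟨f'⟩ := ξ'.exists_framing_of_J (h.symm.trans h1)
  exact Quotient.sound (f.isomorphic f')

end Injectivity

/-! ### The boundary class of a framed bundle. -/

section Boundary

theorem ang_real_mul {r : ℝ} (hr : 0 < r) (x : ℂ) : ang (r * x) = ang x := by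
  by_cases hx : x = 0
  · simp [hx]
  · have hr' : (r : ℂ) ≠ 0 := by simpa using hr.ne'
    ext
    rw [ang_coe hx, ang_coe (mul_ne_zero hr' hx), norm_mul, Complex.norm_real,
      Real.norm_of_nonneg hr.le, Complex.ofReal_mul, mul_div_mul_left _ _ hr']

theorem ang_coe_circle (z : Circle) : ang z = z := by
  ext
  rw [ang_coe (Circle.coe_ne_zero z), Circle.norm_coe]
  simp

theorem collapse_ne_pole_neg_one {w : Disc} (hw : ‖w.1‖ < 1) : collapse w ≠ pole (-1) := by
  rw [Ne, eq_pole_iff, sgn_neg, sgn_one]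
  change ¬ (1 - 2 * ‖w.1‖ ^ 2 = -1)
  nlinarith [norm_nonneg w.1]

theorem collapse_ne_pole_one {w : Disc} (hw : w.1 ≠ 0) : collapse w ≠ pole 1 := by
  rw [Ne, eq_pole_iff, sgn_one]
  change ¬ (1 - 2 * ‖w.1‖ ^ 2 = 1)
  have := norm_pos_iff.2 hw
  nlinarith

theorem collapse_eq_pole {w : Disc} (hw : ‖w.1‖ = 1) : collapse w = pole (-1) := by
  rw [eq_pole_iff, sgn_neg, sgn_one]
  change 1 - 2 * ‖w.1‖ ^ 2 = -1
  rw [hw]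
  norm_num

theorem continuousAt_coord_collapse {ε : ℤˣ} {w : Disc} (hw : collapse w ≠ pole (-ε)) :
    ContinuousAt (fun w => coord ε (collapse w)) w :=
  ContinuousAt.comp (g := coord ε)
    ((contMDiffOn_coord ε).continuousOn.continuousAt (isOpen_compl_singleton.mem_nhds hw))
    collapse.continuous.continuousAt

/-- In the north chart the collapse map is w ↦ w/√(1 - |w|²), a positive multiple of w. -/
theorem ang_coord_collapse {w : Disc} (hw : ‖w.1‖ < 1) : ang (coord 1 (collapse w)) = ang w.1 := by
  have h1 : 0 < 1 - ‖w.1‖ ^ 2 := by nlinarith [norm_nonneg w.1]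
  have h2 : coord 1 (collapse w) = ((√(1 - ‖w.1‖ ^ 2) / (1 - ‖w.1‖ ^ 2) : ℝ) : ℂ) * w.1 := by
    have h3 : 1 + (1 - 2 * ‖w.1‖ ^ 2) = 2 * (1 - ‖w.1‖ ^ 2) := by ring
    apply Complex.ext
    · rw [Complex.re_ofReal_mul]
      change 2 * √(1 - ‖w.1‖ ^ 2) * w.1.re / (1 + sgn 1 * (1 - 2 * ‖w.1‖ ^ 2)) = _
      rw [sgn_one, one_mul, h3]
      field_simp
    · rw [Complex.im_ofReal_mul]
      change 2 * √(1 - ‖w.1‖ ^ 2) * w.1.im / (1 + sgn 1 * (1 - 2 * ‖w.1‖ ^ 2)) = _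
      rw [sgn_one, one_mul, h3]
      field_simp
  rw [h2, ang_real_mul (div_pos (Real.sqrt_pos.2 h1) h1)]

/-- Two loops in a path connected group which differ by a map extending to the disc are
homotopic. -/
theorem homotopic_of_extends_to_disc {G : Type*} [Group G] [TopologicalSpace G]
    [IsTopologicalGroup G] [PathConnectedSpace G] {p q : Path (1 : G) 1} (h : C(Disc, G))
    (hpq : ∀ t, q t = (h (discBoundary 1))⁻¹ * p t * h (discBoundary (circleLoop t))) :
    p.Homotopic q := by
  let κ : Path (1 : G) (h ⟨0, by simp⟩) := (PathConnectedSpace.joined _ _).somePath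
  have hmem : ∀ x : unitInterval × unitInterval,
      ((x.1 : ℝ) : ℂ) * (circleLoop x.2 : ℂ) ∈ Metric.closedBall (0 : ℂ) 1 := fun x => by
    rw [mem_closedBall_zero_iff, norm_mul, Circle.norm_coe, mul_one, Complex.norm_real,
      Real.norm_of_nonneg x.1.2.1]
    exact x.1.2.2
  let d : unitInterval × unitInterval → Disc := fun x => ⟨_, hmem x⟩
  have hd : Continuous d := by
    refine Continuous.subtype_mk ?_ _
    have h1 : Continuous fun t => (circleLoop t : ℂ) :=
      continuous_subtype_val.comp continuous_circleLoop
    fun_prop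
  have hd0 : ∀ t, d (0, t) = ⟨0, by simp⟩ := fun t => Subtype.ext (by simp [d])
  have hd1 : ∀ t, d (1, t) = discBoundary (circleLoop t) := fun t =>
    Subtype.ext (by simp [d, discBoundary])
  have hc0 : circleLoop 0 = 1 := by simp [circleLoop]
  have hc1 : circleLoop 1 = 1 := by simp [circleLoop]
  have hd01 : ∀ s, d (s, 1) = d (s, 0) := fun s => Subtype.ext (by simp [d, hc0, hc1])
  -- The homotopy is K(s, 0)⁻¹ p(t) K(s, t), where `h` is evaluated at the point of radius s. The
  -- left factor keeps the loops based at 1. The path `κ` makes `K` equal to 1 at s = 0 and to `h`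
  -- on the boundary at s = 1; without it `p` would appear conjugated by `h` at the centre.
  let K : unitInterval × unitInterval → G := fun x => κ x.1 * (h ⟨0, by simp⟩)⁻¹ * h (d x)
  have hK : Continuous K := by
    have h1 : Continuous fun x => h (d x) := h.continuous.comp hd
    have h2 : Continuous fun x : unitInterval × unitInterval => κ x.1 :=
      κ.continuous.comp continuous_fst
    exact (h2.mul continuous_const).mul h1
  have hK' : Continuous fun x : unitInterval × unitInterval => K (x.1, 0) :=
    hK.comp (continuous_fst.prodMk continuous_const)
  refine ⟨⟨⟨⟨fun x => (K (x.1, 0))⁻¹ * p x.2 * K x, ?_⟩, fun t => ?_, fun t => ?_⟩, ?_⟩⟩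
  · exact (hK'.inv.mul (p.continuous.comp continuous_snd)).mul hK
  · simp [K, hd0]
  · simp [K, hd1, hpq, hc0]
  · intro s t ht
    rcases ht with rfl | ht
    · simp
    · rw [mem_singleton_iff] at ht
      subst ht
      change (K (s, 0))⁻¹ * p 1 * K (s, 1) = p 1
      rw [show K (s, 1) = K (s, 0) by simp only [K, hd01]]
      simp

variable {V : Type v} [NormedAddCommGroup V] [NormedSpace ℝ V]
  {G : Type u} [Group G] [TopologicalSpace G] [ChartedSpace V G]

namespace PrincipalBundle

variable (η : PrincipalBundle V G)

/-- The boundary operator is well defined. -/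
theorem boundary_subsingleton [LieGroup 𝓘(ℝ, V) ∞ G] [ConnectedSpace G] (f : C(Disc, S2)) :
    (η.boundary f).Subsingleton := by
  have := topologicalGroup_of_lieGroup 𝓘(ℝ, V) ∞ (G := G)
  have := ChartedSpace.locallyPathConnectedSpace V G
  have : PathConnectedSpace G := pathConnectedSpace_iff_connectedSpace.2 inferInstance
  rintro _ ⟨a, F, p, hF, hp, rfl⟩ _ ⟨b, F', q, hF', hq, rfl⟩
  -- Two lifts differ by a map `k` of the disc to G, so the boundary loops satisfy q(z) = k(1)⁻¹
  -- p(z) k(z); the factor k(1) accounts for the change of base point in the fibre.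
  choose k hk using fun w => η.exists_act_eq ((hF' w).trans (hF w).symm)
  let h : C(Disc, G) := ⟨k, η.continuous_of_act_eq F.continuous F'.continuous hk⟩
  have hc0 : circleLoop 0 = 1 := by simp [circleLoop]
  have hb : b = η.act a (k (discBoundary 1)) := by
    have h1 := hq 0
    have h2 := hp 0
    rw [hc0, Path.source, η.act_one] at h1 h2
    rw [← h1, ← h2, hk]
  congr 1
  refine Quotient.sound (homotopic_of_extends_to_disc h fun t => ?_)
  have h1 := hk (discBoundary (circleLoop t))
  rw [hq, hp, hb, ← η.act_mul, ← η.act_mul] at h1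
  have h2 := η.act_left_cancel h1
  change q t = (k (discBoundary 1))⁻¹ * p t * k (discBoundary (circleLoop t))
  rw [mul_assoc, ← h2, inv_mul_cancel_left]

end PrincipalBundle

namespace EquivariantPrincipalBundle

variable {ξ : EquivariantPrincipalBundle V G}

namespace Framing

open Classical in
/-- The lift of the collapse map defined by a framing. -/
def discLift {γ : ℤˣ → SmoothHom V G} (f : ξ.Framing γ) (w : Disc) : ξ.E :=
  if ‖w.1‖ < 1 then f.s 1 (coord 1 (collapse w))
  else ξ.act (f.s (-1) 0) (γ (-1) (rot (ang w.1)) * (γ 1 (rot (ang w.1)))⁻¹)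

variable {γ : ℤˣ → SmoothHom V G} (f : ξ.Framing γ)

/-- The north section has no limit form of its own at the boundary. Expressed through the south
section it does: the south coordinate tends to 0 there while the angle of w stays defined. This
formula gives continuity on the punctured closed disc. -/
theorem discLift_of_ne_zero {w : Disc} (hw : w.1 ≠ 0) :
    f.discLift w = ξ.act (f.s (-1) (coord (-1) (collapse w)))
      (γ (-1) (rot (ang w.1)) * (γ 1 (rot (ang w.1)))⁻¹) := by
  have hpole : collapse w ≠ pole (-(-1)) := by rw [neg_neg]; exact collapse_ne_pole_one hw
  by_cases h : ‖w.1‖ < 1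
  · rw [discLift, if_pos h]
    have h1 : stereo (-(-1)) (coord 1 (collapse w)) = stereo (-1) (coord (-1) (collapse w)) := by
      rw [neg_neg, stereo_coord (collapse_ne_pole_neg_one h), stereo_coord hpole]
    obtain ⟨z, t, hx, hy⟩ := stereo_eq_stereo_neg h1
    have hz : z = ang w.1 := by
      rw [← ang_coord_collapse h, hx, mul_comm, ang_real_mul (Real.exp_pos t), ang_coe_circle]
    have h2 := f.s_neg (-1) z t
    rw [neg_neg, ← hx, ← hy, hz] at h2
    exact h2
  · rw [discLift, if_neg h]
    have hw1 : ‖w.1‖ = 1 := le_antisymm (mem_closedBall_zero_iff.1 w.2) (not_lt.1 h)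
    rw [collapse_eq_pole hw1, coord_pole]

theorem continuous_discLift [LieGroup 𝓘(ℝ, V) ∞ G] : Continuous f.discLift := by
  have := topologicalGroup_of_lieGroup 𝓘(ℝ, V) ∞ (G := G)
  rw [continuous_iff_continuousAt]
  intro w
  by_cases hw : w.1 = 0
  · have hU : {w : Disc | ‖w.1‖ < 1} ∈ 𝓝 w :=
      (isOpen_lt (continuous_norm.comp continuous_subtype_val) continuous_const).mem_nhds
        (by simp [hw])
    have h1 : ContinuousAt (fun w => f.s 1 (coord 1 (collapse w))) w :=
      (f.smooth 1).continuous.continuousAt.comp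
        (continuousAt_coord_collapse (collapse_ne_pole_neg_one (by simp [hw])))
    refine h1.congr ?_
    filter_upwards [hU] with y hy
    exact (if_pos hy).symm
  · have hU : {w : Disc | w.1 ≠ 0} ∈ 𝓝 w :=
      (isOpen_compl_singleton.preimage continuous_subtype_val).mem_nhds hw
    have h1 : ContinuousAt (fun w => f.s (-1) (coord (-1) (collapse w))) w := by
      refine (f.smooth (-1)).continuous.continuousAt.comp (continuousAt_coord_collapse ?_)
      rw [neg_neg]
      exact collapse_ne_pole_one hw
    have h2 : ContinuousAt (fun w : Disc => rot (ang w.1)) w :=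
      contMDiff_rot.continuous.continuousAt.comp
        ((contMDiffOn_ang.continuousOn.continuousAt (isOpen_compl_singleton.mem_nhds hw)).comp
          continuous_subtype_val.continuousAt)
    have h3 : ∀ ε, ContinuousAt (fun w : Disc => γ ε (rot (ang w.1))) w := fun ε =>
      (map_continuous (γ ε)).continuousAt.comp h2
    have h4 : ContinuousAt (fun w : Disc => ξ.act (f.s (-1) (coord (-1) (collapse w)))
        (γ (-1) (rot (ang w.1)) * (γ 1 (rot (ang w.1)))⁻¹)) w :=
      ξ.continuous_act.continuousAt.comp (h1.prodMk ((h3 (-1)).mul (h3 1).inv))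
    refine h4.congr ?_
    filter_upwards [hU] with y hy
    exact (f.discLift_of_ne_zero hy).symm

theorem proj_discLift (w : Disc) : ξ.proj (f.discLift w) = collapse w := by
  by_cases hw : w.1 = 0
  · have h : ‖w.1‖ < 1 := by simp [hw]
    rw [discLift, if_pos h, f.proj_s, stereo_coord (collapse_ne_pole_neg_one h)]
  · rw [f.discLift_of_ne_zero hw, ξ.proj_act, f.proj_s, stereo_coord]
    rw [neg_neg]
    exact collapse_ne_pole_one hw

theorem discLift_boundary (z : Circle) : f.discLift (discBoundary z) =
    ξ.act (f.s (-1) 0) (γ (-1) (rot z) * (γ 1 (rot z))⁻¹) := by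
  rw [discLift, if_neg (by rw [discBoundary, Circle.norm_coe]; exact lt_irrefl 1)]
  change ξ.act _ (γ (-1) (rot (ang (z : ℂ))) * (γ 1 (rot (ang (z : ℂ))))⁻¹) = _
  rw [ang_coe_circle]

end Framing

theorem C_eq_psi [LieGroup 𝓘(ℝ, V) ∞ G] [FiniteDimensional ℝ V] [ConnectedSpace G]
    {α β : SmoothHom V G}
    (h : J (Quotient.mk (isoSetoid V G) ξ) =
      (Quotient.mk (conjSetoid V G) α, Quotient.mk (conjSetoid V G) β)) :
    ξ.toPrincipalBundle.C = {psi α β} := by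
  obtain ⟨f⟩ := ξ.exists_framing_of_J h
  refine (ξ.boundary_subsingleton collapse).eq_singleton_of_mem ?_
  refine ⟨f.s (-1) 0, ⟨f.discLift, f.continuous_discLift⟩, psiLoop α β, f.proj_discLift,
    fun t => ?_, rfl⟩
  have := f.discLift_boundary (circleLoop t)
  rw [repPair_one, repPair_neg_one] at this
  exact this

end EquivariantPrincipalBundle

end Boundary

/-! ### Manifolds glued from charts with values in a manifold -/

section Gluing

variable {F : Type*} [NormedAddCommGroup F] [NormedSpace ℝ F] {H : Type*} [TopologicalSpace H]
  {I : ModelWithCorners ℝ F H} {M : Type*} [TopologicalSpace M] [ChartedSpace H M]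
  {X : Type*} [TopologicalSpace X] {ι : Type*} (e : ι → OpenPartialHomeomorph X M)

variable (H) in
/-- The charted space structure obtained by composing the charts of `M` with a covering family of
open partial homeomorphisms to `M`. -/
@[reducible]
def gluedChartedSpace (hcov : ∀ p, ∃ i, p ∈ (e i).source) : ChartedSpace H X where
  atlas := {φ | ∃ i, ∃ c ∈ atlas H M, φ = (e i).trans c}
  chartAt p := (e (hcov p).choose).trans (chartAt H (e (hcov p).choose p))
  mem_chart_source p := by simp [(hcov p).choose_spec]
  chart_mem_atlas p := ⟨_, _, chart_mem_atlas _ _, rfl⟩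

variable [IsManifold I ∞ M]

/-- A chart change of `X` is c⁻¹ followed by the gluing map and c'. The gluing map followed by c'
belongs to the maximal atlas of `M`, hence is compatible with c. -/
theorem isManifold_glued (hcov : ∀ p, ∃ i, p ∈ (e i).source)
    (he : ∀ i j, ContMDiffOn I I ∞ ((e i).symm.trans (e j)) ((e i).symm.trans (e j)).source) :
    letI := gluedChartedSpace H e hcov
    IsManifold I ∞ X := by
  let _ := gluedChartedSpace H e hcov
  refine { compatible := ?_ }
  rintro _ _ ⟨i, c, hc, rfl⟩ ⟨j, c', hc', rfl⟩
  have hsymm : ((e i).symm.trans (e j)).symm = (e j).symm.trans (e i) := by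
    rw [OpenPartialHomeomorph.trans_symm_eq_symm_trans_symm, OpenPartialHomeomorph.symm_symm]
  have hmax : ((e i).symm.trans (e j)).trans c' ∈ IsManifold.maximalAtlas I ∞ M := by
    apply OpenPartialHomeomorph.mem_maximalAtlas_of_contMDiffOn
    · refine (contMDiffOn_of_mem_maximalAtlas (IsManifold.subset_maximalAtlas hc')).comp
        ((he i j).mono fun x hx => ?_) fun x hx => ?_
      · rw [OpenPartialHomeomorph.trans_source] at hx; exact hx.1
      · rw [OpenPartialHomeomorph.trans_source] at hx; exact hx.2
    · rw [OpenPartialHomeomorph.trans_symm_eq_symm_trans_symm, hsymm]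
      refine (he j i).comp ((contMDiffOn_symm_of_mem_maximalAtlas
        (IsManifold.subset_maximalAtlas hc')).mono fun x hx => ?_) fun x hx => ?_
      · rw [OpenPartialHomeomorph.trans_target] at hx; exact hx.1
      · rw [OpenPartialHomeomorph.trans_target] at hx
        rw [← hsymm]; exact hx.2
  have h := IsManifold.compatible_of_mem_maximalAtlas
    (IsManifold.subset_maximalAtlas (I := I) (n := ∞) hc) hmax
  simpa only [OpenPartialHomeomorph.trans_symm_eq_symm_trans_symm,
    OpenPartialHomeomorph.trans_assoc] using h

theorem contMDiffOn_glued (hcov : ∀ p, ∃ i, p ∈ (e i).source)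
    (he : ∀ i j, ContMDiffOn I I ∞ ((e i).symm.trans (e j)) ((e i).symm.trans (e j)).source)
    (i : ι) :
    letI := gluedChartedSpace H e hcov
    ContMDiffOn I I ∞ (e i) (e i).source := by
  let _ := gluedChartedSpace H e hcov
  have := isManifold_glued e hcov he
  intro p hp
  let c := chartAt H (e i p)
  have hc : c ∈ atlas H M := chart_mem_atlas _ _
  have h1 : ContMDiffOn I I ∞ ((e i).trans c) ((e i).trans c).source :=
    contMDiffOn_of_mem_maximalAtlas (IsManifold.subset_maximalAtlas ⟨i, c, hc, rfl⟩)
  have h2 := contMDiffOn_symm_of_mem_maximalAtlas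
    (IsManifold.subset_maximalAtlas (I := I) (n := ∞) hc)
  have hp' : p ∈ ((e i).trans c).source := by simp [c, hp]
  have h3 : ContMDiffOn I I ∞ (c.symm ∘ (e i).trans c) ((e i).trans c).source :=
    h2.comp h1 fun x hx => c.map_source hx.2
  refine ((h3.congr fun x hx => ?_).contMDiffAt
    (((e i).trans c).open_source.mem_nhds hp')).contMDiffWithinAt
  exact (c.left_inv hx.2).symm

theorem contMDiffOn_glued_symm (hcov : ∀ p, ∃ i, p ∈ (e i).source)
    (he : ∀ i j, ContMDiffOn I I ∞ ((e i).symm.trans (e j)) ((e i).symm.trans (e j)).source)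
    (i : ι) :
    letI := gluedChartedSpace H e hcov
    ContMDiffOn I I ∞ (e i).symm (e i).target := by
  let _ := gluedChartedSpace H e hcov
  have := isManifold_glued e hcov he
  intro p hp
  let c := chartAt H p
  have hc : c ∈ atlas H M := chart_mem_atlas _ _
  have h1 : ContMDiffOn I I ∞ ((e i).trans c).symm ((e i).trans c).target :=
    contMDiffOn_symm_of_mem_maximalAtlas (IsManifold.subset_maximalAtlas ⟨i, c, hc, rfl⟩)
  have h2 := contMDiffOn_of_mem_maximalAtlas
    (IsManifold.subset_maximalAtlas (I := I) (n := ∞) hc)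
  have hU : IsOpen (c.source ∩ (e i).target) := c.open_source.inter (e i).open_target
  have h3 : ContMDiffOn I I ∞ (((e i).trans c).symm ∘ c) (c.source ∩ (e i).target) := by
    refine h1.comp (h2.mono inter_subset_left) fun x hx => ?_
    rw [OpenPartialHomeomorph.trans_target]
    refine ⟨c.map_source hx.1, ?_⟩
    rw [mem_preimage, c.left_inv hx.1]
    exact hx.2
  refine ((h3.congr fun x hx => ?_).contMDiffAt
    (hU.mem_nhds ⟨mem_chart_source _ _, hp⟩)).contMDiffWithinAt
  simp [c.left_inv hx.1]

theorem secondCountableTopology_glued [Countable ι] [SecondCountableTopology M]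
    (hcov : ∀ p, ∃ i, p ∈ (e i).source) :
    SecondCountableTopology X := by
  have : ∀ i, SecondCountableTopology (e i).source := fun i =>
    (e i).toHomeomorphSourceTarget.secondCountableTopology
  exact TopologicalSpace.secondCountableTopology_of_countable_cover
    (fun i => (e i).open_source) (iUnion_eq_univ_iff.2 hcov)

end Gluing

/-! ### The angle on the sphere -/

/-- The first two coordinates of a point of the sphere, as a complex number. -/
def planar (x : S2) : ℂ := ⟨x.1 0, x.1 1⟩

theorem contMDiff_planar : ContMDiff (𝓡 2) 𝓘(ℝ, ℂ) ∞ planar :=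
  (Complex.equivRealProdCLM.symm.contDiff (n := ∞)).contMDiff.comp
    ((contMDiff_S2_coord 0).prodMk_space (contMDiff_S2_coord 1))

theorem planar_ne_zero {x : S2} (h1 : x ≠ pole 1) (h2 : x ≠ pole (-1)) : planar x ≠ 0 := by
  intro h
  have h0 : x.1 0 = 0 := congrArg Complex.re h
  have h0' : x.1 1 = 0 := congrArg Complex.im h
  have hs := x.sq_sum
  rw [Ne, eq_pole_iff, sgn_one] at h1
  rw [Ne, eq_pole_iff, sgn_neg, sgn_one] at h2
  rw [h0, h0'] at hs
  have : (x.1 2 - 1) * (x.1 2 + 1) = 0 := by linear_combination hs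
  rcases mul_eq_zero.1 this with h | h
  · exact h1 (by linarith)
  · exact h2 (by linarith)

theorem planar_rotate (z : Circle) (x : S2) : planar (rotate (rot z) x) = z * planar x := by
  apply Complex.ext <;> simp [planar, rotate, rot] <;> ring

/-- The rotation carrying a meridian to the one through a given point. -/
def angle (x : S2) : SO2 := rot (ang (planar x))

theorem contMDiffOn_angle : ContMDiffOn (𝓡 2) (𝓡 1) ∞ angle {x | planar x ≠ 0} :=
  contMDiff_rot.comp_contMDiffOn
    (contMDiffOn_ang.comp contMDiff_planar.contMDiffOn fun _ hx => hx)

theorem angle_rotate (A : SO2) {x : S2} (hx : planar x ≠ 0) :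
    angle (rotate A x) = A * angle x := by
  obtain ⟨z, rfl⟩ := rot_surjective A
  rw [angle, angle, planar_rotate, ang_circle_mul z hx, rot_mul]

theorem rotate_eq_pole_iff (A : SO2) (x : S2) (ε : ℤˣ) : rotate A x = pole ε ↔ x = pole ε := by
  rw [eq_pole_iff, eq_pole_iff]
  rfl

/-! ### The bundle with given isotropy representations -/

section Clutching

variable {V : Type v} [NormedAddCommGroup V] [NormedSpace ℝ V]
  {G : Type u} [Group G] [TopologicalSpace G] [ChartedSpace V G]

namespace Clutching

variable (γ : ℤˣ → SmoothHom V G)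

/-- The transition function of the clutching construction. -/
def trans (i j : ℤˣ) (x : S2) : G := γ j (angle x) * (γ i (angle x))⁻¹

theorem trans_self (i : ℤˣ) (x : S2) : trans γ i i x = 1 := mul_inv_cancel _

theorem trans_mul (i j k : ℤˣ) (x : S2) : trans γ j k x * trans γ i j x = trans γ i k x := by
  simp [trans]

theorem planar_ne_zero_of_ne {i j : ℤˣ} (hij : i ≠ j) {x : S2}
    (hx : x ∈ ({pole (-i)}ᶜ ∩ {pole (-j)}ᶜ : Set S2)) : planar x ≠ 0 := by
  rcases Int.units_eq_one_or i with rfl | rfl <;> rcases Int.units_eq_one_or j with rfl | rfl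
  · exact absurd rfl hij
  · exact planar_ne_zero (by simpa using hx.2) (by simpa using hx.1)
  · exact planar_ne_zero (by simpa using hx.1) (by simpa using hx.2)
  · exact absurd rfl hij

/-- This is the compatibility that lets A act by γ_i(A) on the fibre coordinate of every chart i. It
follows from the equivariance of `angle`, which fails at the poles; a pole lies only in the overlap
of a chart with itself, where the transition function is 1. -/
theorem trans_rotate (i j : ℤˣ) (A : SO2) {x : S2}
    (hx : x ∈ ({pole (-i)}ᶜ ∩ {pole (-j)}ᶜ : Set S2)) :
    trans γ i j (rotate A x) * γ i A = γ j A * trans γ i j x := by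
  by_cases hij : i = j
  · subst hij
    simp [trans_self]
  · rw [trans, trans, angle_rotate A (planar_ne_zero_of_ne hij hx), map_mul, map_mul]
    group

variable [LieGroup 𝓘(ℝ, V) ∞ G]

theorem contMDiffOn_trans (i j : ℤˣ) :
    ContMDiffOn (𝓡 2) 𝓘(ℝ, V) ∞ (trans γ i j) ({pole (-i)}ᶜ ∩ {pole (-j)}ᶜ) := by
  by_cases hij : i = j
  · subst hij
    exact contMDiffOn_const.congr fun x _ => trans_self γ i x
  · have h : ContMDiffOn (𝓡 2) (𝓡 1) ∞ angle ({pole (-i)}ᶜ ∩ {pole (-j)}ᶜ) :=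
      contMDiffOn_angle.mono fun x hx => planar_ne_zero_of_ne hij hx
    exact ((γ j).contMDiff_toFun.comp_contMDiffOn h).mul
      ((γ i).contMDiff_toFun.comp_contMDiffOn h).inv

theorem contMDiffOn_coordChange (i j : ℤˣ) :
    ContMDiffOn ((𝓡 2).prod 𝓘(ℝ, V)) 𝓘(ℝ, V) ∞ (fun q : S2 × G => trans γ i j q.1 * q.2)
      (({pole (-i)}ᶜ ∩ {pole (-j)}ᶜ) ×ˢ univ) :=
  ((contMDiffOn_trans γ i j).comp contMDiff_fst.contMDiffOn fun _ hq => hq.1).mul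
    contMDiff_snd.contMDiffOn

open Classical in
/-- The fibre bundle over the sphere glued by the transition functions. -/
def core : FiberBundleCore ℤˣ S2 G where
  baseSet i := {pole (-i)}ᶜ
  isOpen_baseSet _ := isOpen_compl_singleton
  -- The preferred chart is constant on orbits of the rotations, so the action can be written in
  -- preferred charts without a coordinate change.
  indexAt x := if x = pole 1 then 1 else -1
  mem_baseSet_at x := by
    by_cases h : x = pole 1
    · rw [if_pos h, h]; exact pole_ne_neg 1
    · rw [if_neg h, neg_neg]; exact h
  coordChange i j x g := trans γ i j x * g
  coordChange_self i x _ g := by rw [trans_self, one_mul]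
  continuousOn_coordChange i j := (contMDiffOn_coordChange γ i j).continuousOn
  coordChange_comp i j k x _ g := by rw [← mul_assoc, trans_mul]

/-- The total space of the clutching construction. -/
abbrev Total : Type u := (core γ).TotalSpace

/-- The fibre coordinate of a point of the total space. -/
def fib (p : Total γ) : G := p.2

/-- The point of the total space with given base point and fibre coordinate. -/
def mk (x : S2) (g : G) : Total γ := ⟨x, g⟩

variable {γ} in
theorem Total.ext {p q : Total γ} (h1 : p.1 = q.1) (h2 : fib γ p = fib γ q) : p = q := by
  obtain ⟨x, g⟩ := p
  obtain ⟨y, h⟩ := q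
  obtain rfl : x = y := h1
  obtain rfl : g = h := h2
  rfl

/-- The trivializations of the clutching construction. -/
def triv (i : ℤˣ) : Bundle.Trivialization G (core γ).proj := (core γ).localTriv i

theorem mem_triv_source {i : ℤˣ} {p : Total γ} :
    p ∈ (triv γ i).source ↔ p.1 ∈ ({pole (-i)}ᶜ : Set S2) := Iff.rfl

theorem exists_mem_triv_source (p : Total γ) :
    ∃ i, p ∈ (triv γ i).toOpenPartialHomeomorph.source := by
  obtain ⟨i, hi⟩ := exists_ne_pole p.1
  exact ⟨i, hi⟩

theorem triv_change (i j : ℤˣ) {q : S2 × G}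
    (hq : q ∈ ((triv γ i).toOpenPartialHomeomorph.symm.trans
      (triv γ j).toOpenPartialHomeomorph).source) :
    q.1 ∈ ({pole (-i)}ᶜ ∩ {pole (-j)}ᶜ : Set S2) ∧
    (triv γ i).toOpenPartialHomeomorph.symm.trans (triv γ j).toOpenPartialHomeomorph q =
      (q.1, trans γ i j q.1 * q.2) := by
  rw [OpenPartialHomeomorph.trans_source] at hq
  refine ⟨⟨hq.1.1, hq.2⟩, Prod.ext rfl ?_⟩
  change trans γ ((core γ).indexAt q.1) j q.1 * (trans γ i ((core γ).indexAt q.1) q.1 * q.2) =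
    trans γ i j q.1 * q.2
  rw [← mul_assoc, trans_mul]

theorem contMDiffOn_triv_change (i j : ℤˣ) :
    ContMDiffOn ((𝓡 2).prod 𝓘(ℝ, V)) ((𝓡 2).prod 𝓘(ℝ, V)) ∞
      ((triv γ i).toOpenPartialHomeomorph.symm.trans (triv γ j).toOpenPartialHomeomorph)
      ((triv γ i).toOpenPartialHomeomorph.symm.trans (triv γ j).toOpenPartialHomeomorph).source := by
  have h : ContMDiffOn ((𝓡 2).prod 𝓘(ℝ, V)) ((𝓡 2).prod 𝓘(ℝ, V)) ∞
      (fun q : S2 × G => (q.1, trans γ i j q.1 * q.2)) (({pole (-i)}ᶜ ∩ {pole (-j)}ᶜ) ×ˢ univ) :=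
    contMDiff_fst.contMDiffOn.prodMk (contMDiffOn_coordChange γ i j)
  exact (h.mono fun q hq => ⟨(triv_change γ i j hq).1, mem_univ _⟩).congr
    fun q hq => (triv_change γ i j hq).2

instance : ChartedSpace (ModelProd (EuclideanSpace ℝ (Fin 2)) V) (Total γ) :=
  gluedChartedSpace _ (fun i => (triv γ i).toOpenPartialHomeomorph) (exists_mem_triv_source γ)

instance : IsManifold (totalModel V) ∞ (Total γ) :=
  isManifold_glued (fun i => (triv γ i).toOpenPartialHomeomorph) (exists_mem_triv_source γ)
    (contMDiffOn_triv_change γ)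

theorem contMDiffOn_triv (i : ℤˣ) :
    ContMDiffOn (totalModel V) ((𝓡 2).prod 𝓘(ℝ, V)) ∞ (triv γ i) (triv γ i).source :=
  contMDiffOn_glued (fun i => (triv γ i).toOpenPartialHomeomorph) (exists_mem_triv_source γ)
    (contMDiffOn_triv_change γ) i

theorem contMDiffOn_triv_symm (i : ℤˣ) :
    ContMDiffOn ((𝓡 2).prod 𝓘(ℝ, V)) (totalModel V) ∞ (triv γ i).toOpenPartialHomeomorph.symm
      (triv γ i).target :=
  contMDiffOn_glued_symm (fun i => (triv γ i).toOpenPartialHomeomorph) (exists_mem_triv_source γ)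
    (contMDiffOn_triv_change γ) i

instance [SecondCountableTopology G] : SecondCountableTopology (Total γ) :=
  secondCountableTopology_glued (fun i => (triv γ i).toOpenPartialHomeomorph)
    (exists_mem_triv_source γ)

instance [T2Space G] : T2Space (Total γ) := by
  refine ⟨fun p q hpq => ?_⟩
  by_cases h : p.1 = q.1
  · obtain ⟨i, hi⟩ := exists_ne_pole p.1
    have hp : p ∈ (triv γ i).source := hi
    have hq : q ∈ (triv γ i).source := by rw [mem_triv_source, ← h]; exact hi
    obtain ⟨A, B, hA, hB, hpA, hqB, hAB⟩ := t2_separation ((triv γ i).injOn.ne hp hq hpq)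
    exact ⟨_, _, (triv γ i).toOpenPartialHomeomorph.isOpen_inter_preimage hA,
      (triv γ i).toOpenPartialHomeomorph.isOpen_inter_preimage hB, ⟨hp, hpA⟩, ⟨hq, hqB⟩,
      (hAB.preimage _).mono inter_subset_right inter_subset_right⟩
  · obtain ⟨A, B, hA, hB, hpA, hqB, hAB⟩ := t2_separation h
    exact ⟨_, _, hA.preimage (core γ).continuous_proj, hB.preimage (core γ).continuous_proj,
      hpA, hqB, hAB.preimage _⟩

/-- The right action of `G`. -/
def act (p : Total γ) (g : G) : Total γ := mk γ p.1 (fib γ p * g)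

/-- The left action of `SO(2)`. -/
def rotAct (A : SO2) (p : Total γ) : Total γ :=
  mk γ (rotate A p.1) (γ ((core γ).indexAt p.1) A * fib γ p)

theorem indexAt_rotate (A : SO2) (x : S2) :
    (core γ).indexAt (rotate A x) = (core γ).indexAt x := by
  simp only [core, rotate_eq_pole_iff]

/-- Coordinate changes are left multiplications, so they commute with the right action. -/
theorem triv_act (i : ℤˣ) (p : Total γ) (g : G) :
    triv γ i (act γ p g) = ((triv γ i p).1, (triv γ i p).2 * g) :=
  Prod.ext rfl (mul_assoc _ _ _).symm

/-- The action is defined through the preferred chart, which jumps at the north pole. Smoothness can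
be read off only once the same formula is known in each fixed chart. -/
theorem triv_rotAct (i : ℤˣ) (A : SO2) {p : Total γ} (hp : p ∈ (triv γ i).source) :
    triv γ i (rotAct γ A p) = (rotate A (triv γ i p).1, γ i A * (triv γ i p).2) := by
  refine Prod.ext rfl ?_
  change trans γ ((core γ).indexAt (rotate A p.1)) i (rotate A p.1) *
    (γ ((core γ).indexAt p.1) A * fib γ p) =
      γ i A * (trans γ ((core γ).indexAt p.1) i p.1 * fib γ p)
  rw [indexAt_rotate, ← mul_assoc, ← mul_assoc,
    trans_rotate γ _ _ A ⟨(core γ).mem_baseSet_at p.1, hp⟩]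

theorem contMDiff_act : ContMDiff ((totalModel V).prod 𝓘(ℝ, V)) (totalModel V) ∞
    fun q : Total γ × G => act γ q.1 q.2 := by
  rintro ⟨p, g⟩
  obtain ⟨i, hi⟩ := exists_mem_triv_source γ p
  let U : Set (Total γ × G) := (triv γ i).source ×ˢ univ
  have hU : IsOpen U := (triv γ i).open_source.prod isOpen_univ
  have h1 : ContMDiffOn ((totalModel V).prod 𝓘(ℝ, V)) ((𝓡 2).prod 𝓘(ℝ, V)) ∞
      (fun q : Total γ × G => triv γ i q.1) U :=
    (contMDiffOn_triv γ i).comp contMDiff_fst.contMDiffOn fun q hq => hq.1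
  have h2 : ContMDiffOn ((totalModel V).prod 𝓘(ℝ, V)) ((𝓡 2).prod 𝓘(ℝ, V)) ∞
      (fun q : Total γ × G => ((triv γ i q.1).1, (triv γ i q.1).2 * q.2)) U :=
    (contMDiff_fst.comp_contMDiffOn h1).prodMk
      ((contMDiff_snd.comp_contMDiffOn h1).mul contMDiff_snd.contMDiffOn)
  have h3 := (contMDiffOn_triv_symm γ i).comp h2 fun q hq => (triv γ i).mem_target.2 hq.1
  refine (h3.congr fun q hq => ?_).contMDiffAt (hU.mem_nhds ⟨hi, mem_univ g⟩)
  simp only [Function.comp]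
  rw [← triv_act]
  exact ((triv γ i).left_inv (x := act γ q.1 q.2) hq.1).symm

theorem contMDiff_rotAct : ContMDiff ((𝓡 1).prod (totalModel V)) (totalModel V) ∞
    fun q : SO2 × Total γ => rotAct γ q.1 q.2 := by
  rintro ⟨A, p⟩
  obtain ⟨i, hi⟩ := exists_mem_triv_source γ p
  let U : Set (SO2 × Total γ) := univ ×ˢ (triv γ i).source
  have hU : IsOpen U := isOpen_univ.prod (triv γ i).open_source
  have h1 : ContMDiffOn ((𝓡 1).prod (totalModel V)) ((𝓡 2).prod 𝓘(ℝ, V)) ∞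
      (fun q : SO2 × Total γ => triv γ i q.2) U :=
    (contMDiffOn_triv γ i).comp contMDiff_snd.contMDiffOn fun q hq => hq.2
  have hA : ContMDiffOn ((𝓡 1).prod (totalModel V)) (𝓡 1) ∞ (fun q : SO2 × Total γ => q.1) U :=
    contMDiff_fst.contMDiffOn
  have h2 : ContMDiffOn ((𝓡 1).prod (totalModel V)) ((𝓡 2).prod 𝓘(ℝ, V)) ∞
      (fun q : SO2 × Total γ => (rotate q.1 (triv γ i q.2).1, γ i q.1 * (triv γ i q.2).2)) U :=
    (contMDiff_rotate.comp_contMDiffOn (hA.prodMk (contMDiff_fst.comp_contMDiffOn h1))).prodMk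
      (((γ i).contMDiff_toFun.comp_contMDiffOn hA).mul (contMDiff_snd.comp_contMDiffOn h1))
  have hmem : ∀ q ∈ U, rotate q.1 q.2.1 ∈ ({pole (-i)}ᶜ : Set S2) := fun q hq => by
    rw [mem_compl_singleton_iff, Ne, rotate_eq_pole_iff]
    exact hq.2
  have h3 := (contMDiffOn_triv_symm γ i).comp h2 fun q hq => (triv γ i).mem_target.2 (hmem q hq)
  refine (h3.congr fun q hq => ?_).contMDiffAt (hU.mem_nhds ⟨mem_univ A, hi⟩)
  simp only [Function.comp]
  rw [← triv_rotAct γ i q.1 hq.2]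
  exact ((triv γ i).left_inv (x := rotAct γ q.1 q.2) (hmem q hq)).symm

theorem contMDiff_proj : ContMDiff (totalModel V) (𝓡 2) ∞ (core γ).proj := by
  intro p
  obtain ⟨i, hi⟩ := exists_mem_triv_source γ p
  exact (contMDiff_fst.comp_contMDiffOn (contMDiffOn_triv γ i)).contMDiffAt
    ((triv γ i).open_source.mem_nhds hi)

/-- The equivariant bundle with isotropy representation `γ ε` at the pole `ε`. -/
def bundle [T2Space G] [SecondCountableTopology G] : EquivariantPrincipalBundle V G where
  E := Total γ
  proj := (core γ).proj
  proj_smooth := contMDiff_proj γ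
  act := act γ
  act_one p := Total.ext rfl (mul_one _)
  act_mul p g h := Total.ext rfl (mul_assoc _ _ _).symm
  act_free p g h := mul_eq_left.1 (congrArg (fib γ) h)
  act_smooth := contMDiff_act γ
  proj_act _ _ := rfl
  locally_trivial x := by
    obtain ⟨i, hi⟩ := exists_ne_pole x
    exact ⟨triv γ i, hi, contMDiffOn_triv γ i, contMDiffOn_triv_symm γ i,
      fun p _ g => triv_act γ i p g⟩
  rotAct := rotAct γ
  rotAct_one p := by
    refine Total.ext (rotate_one _) ?_
    change γ _ 1 * fib γ p = fib γ p
    rw [map_one, one_mul]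
  rotAct_mul A B p := by
    refine Total.ext (rotate_mul _ _ _) ?_
    change γ _ (A * B) * fib γ p =
      γ ((core γ).indexAt (rotate B p.1)) A * (γ ((core γ).indexAt p.1) B * fib γ p)
    rw [indexAt_rotate, map_mul, mul_assoc]
  rotAct_smooth := contMDiff_rotAct γ
  rotAct_act A p g := Total.ext rfl (mul_assoc _ _ _).symm
  proj_rotAct _ _ := rfl

/-- The point over the pole with fibre coordinate 1 in the chart centred there has isotropy
representation exactly `γ i`. -/
theorem bundle_isotropyClass [T2Space G] [SecondCountableTopology G] {x : S2}
    (hx : ∀ A, rotate A x = x) (i : ℤˣ) (hxi : x = pole i) :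
    (bundle γ).isotropyClass x hx = Quotient.mk _ (γ i) := by
  have hmem : x ∈ (triv γ i).baseSet := by rw [hxi]; exact pole_ne_neg i
  have hmem' : (x, (1 : G)) ∈ (triv γ i).target := (triv γ i).mem_target.2 hmem
  let a : Total γ := (triv γ i).toOpenPartialHomeomorph.symm (x, 1)
  have ha : triv γ i a = (x, 1) := (triv γ i).right_inv hmem'
  have has : a ∈ (triv γ i).source := (triv γ i).map_target hmem'
  refine (bundle γ).isotropyClass_eq x hx a rfl (γ i) fun A => ?_
  refine (triv γ i).toOpenPartialHomeomorph.injOn (?_ : rotAct γ A a ∈ _)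
    (has : act γ a (γ i A) ∈ (triv γ i).source) ?_
  · change rotate A x ∈ (triv γ i).baseSet
    rw [hx]
    exact hmem
  · change triv γ i (rotAct γ A a) = triv γ i (act γ a (γ i A))
    rw [triv_rotAct γ i A has, triv_act, ha, hx, mul_one, one_mul]

end Clutching

theorem J_surjective [LieGroup 𝓘(ℝ, V) ∞ G] [T2Space G] [SecondCountableTopology G] :
    Function.Surjective (J (V := V) (G := G)) := by
  rintro ⟨c, d⟩
  induction c using Quotient.inductionOn with | _ α
  induction d using Quotient.inductionOn with | _ β
  refine ⟨Quotient.mk _ (Clutching.bundle (EquivariantPrincipalBundle.repPair α β)),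
    Prod.ext ?_ ?_⟩
  · refine (Clutching.bundle_isotropyClass _ rotate_southPole (-1) pole_neg_one.symm).trans ?_
    rw [EquivariantPrincipalBundle.repPair_neg_one]
  · refine (Clutching.bundle_isotropyClass _ rotate_northPole 1 pole_one.symm).trans ?_
    rw [EquivariantPrincipalBundle.repPair_one]

end Clutching

end EquivariantBundle

theorem theoremA {V : Type*} [NormedAddCommGroup V] [NormedSpace ℝ V] [FiniteDimensional ℝ V]
    {G : Type*} [Group G] [TopologicalSpace G] [ChartedSpace V G] [LieGroup 𝓘(ℝ, V) ∞ G]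
    [T2Space G] [SecondCountableTopology G] [ConnectedSpace G] :
    Function.Bijective (EquivariantBundle.J (V := V) (G := G)) ∧
    ∀ (ξ : EquivariantBundle.EquivariantPrincipalBundle V G)
      (α β : EquivariantBundle.SmoothHom V G),
      EquivariantBundle.J (Quotient.mk (EquivariantBundle.isoSetoid V G) ξ) =
        (Quotient.mk (EquivariantBundle.conjSetoid V G) α,
          Quotient.mk (EquivariantBundle.conjSetoid V G) β) →
      ξ.toPrincipalBundle.C = {EquivariantBundle.psi α β} :=
  ⟨⟨EquivariantBundle.J_injective, EquivariantBundle.J_surjective⟩,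
    fun _ _ _ h => EquivariantBundle.EquivariantPrincipalBundle.C_eq_psi h⟩

end
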